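/- Let $d\ge 1$ be an integer and let $1\le q<p\le\infty$. For a box $I=[a_1,b_1]\times\dots\times[a_d,b_d]\subset\mathbb R^d$ with $a_i<b_i$ for all $i$, and for $B>0$, let $\mathcal C_p(I,B)$ be the class of all convex functions $f:I\to\mathbb R$ with $\int_I|f(x)|^p\,dx\le B^p$ if $p<\infty$, and with $\sup_{x\in I}|f(x)|\le B$ if $p=\infty$. For $\epsilon>0$ let $M(\mathcal C_p(I,B),\epsilon;L_q(I))$ be the smallest number (possibly $\infty$) of closed balls of radius $\epsilon$, with respect to the pseudometric $\left(\int_I|f-g|^q\,dx\right)^{1/q}$ on the space of functions with finite $L_q(I)$ norm, whose union contains $\mathcal C_p(I,B)$. The centres of the balls need not belong to $\mathcal C_p(I,B)$. Then there exist positive constants $c_1$, $c_2$ and $\epsilon_0$, depending only on $d$, $p$ and $q$, such that for every such box $I$ and every $B>0$, with the convention $1/\infty=0$, $$\log M(\mathcal C_p(I,B),\epsilon;L_q(I))\le c_1\left(\frac{\epsilon}{B\prod_{i=1}^d(b_i-a_i)^{1/q-1/p}}\right)^{-d/2}\qquad\text{for every }\epsilon>0,$$ and $$\log M(\mathcal C_p(I,B),\epsilon;L_q(I))\ge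 c_2\left(\frac{\epsilon}{B\prod_{i=1}^d(b_i-a_i)^{1/q-1/p}}\right)^{-d/2}\qquad\text{whenever }0<\epsilon\le\epsilon_0\,B\prod_{i=1}^d(b_i-a_i)^{1/q-1/p}.$$ -/

import Mathlib

open MeasureTheory
open scoped ENNReal

noncomputable section

/-- Real functions with finite `L_q(μ)` norm, as functions (not as almost-everywhere classes). -/
def LqFun {α : Type*} [MeasurableSpace α] (q : ℝ≥0∞) (μ : Measure α) : Type _ :=
  {f : α → ℝ // MemLp f q μ}

/-- The `L_q` pseudometric `(∫ |f - g|^q dμ)^{1/q}` on `LqFun q μ`. -/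
instance LqFun.instPseudoEMetricSpace {α : Type*} [MeasurableSpace α] (q : ℝ≥0∞)
    [hq : Fact (1 ≤ q)] (μ : Measure α) : PseudoEMetricSpace (LqFun q μ) where
  edist f g := eLpNorm (fun x => f.1 x - g.1 x) q μ
  edist_self f := by
    simp only [sub_self]
    exact eLpNorm_zero
  edist_comm f g := eLpNorm_sub_comm f.1 g.1 q μ
  edist_triangle f g h := by
    have e : (fun x => f.1 x - h.1 x)
        = (fun x => f.1 x - g.1 x) + (fun x => g.1 x - h.1 x) := by
      funext x
      simp
    rw [e]
    exact eLpNorm_add_le (f.2.1.sub g.2.1) (g.2.1.sub h.2.1) hq.out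

/-- The class `C_p(I, B)` of convex functions on the box `I = ∏ i, [a i, b i]` such that
`∫_I |f|^p ≤ B^p` if `p < ∞`, and `|f| ≤ B` everywhere on `I` if `p = ∞`.
Values outside `I` are irrelevant. -/
def convexClass {d : ℕ} (p : ℝ≥0∞) (a b : Fin d → ℝ) (B : ℝ) : Set ((Fin d → ℝ) → ℝ) :=
  {f | ConvexOn ℝ (Set.Icc a b) f ∧
    if p = ∞ then ∀ x ∈ Set.Icc a b, |f x| ≤ B
    else ∫⁻ x in Set.Icc a b, ENNReal.ofReal |f x| ^ p.toReal
      ≤ ENNReal.ofReal B ^ p.toReal}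

/-- Every member of `C_p(I, B)` has finite `L_q(I)` norm for `q ≤ p`, so viewing the class inside
`LqFun` loses nothing. -/
theorem memLp_of_mem_convexClass {d : ℕ} {p q : ℝ≥0∞} (hp : p ≠ 0) (hqp : q ≤ p)
    {a b : Fin d → ℝ} {B : ℝ} {f : (Fin d → ℝ) → ℝ} (hf : f ∈ convexClass p a b B) :
    MemLp f q (volume.restrict (Set.Icc a b)) := by
  obtain ⟨hc, hb⟩ := hf
  haveI : IsFiniteMeasure (volume.restrict (Set.Icc a b)) :=
    ⟨by simpa using (isCompact_Icc (a := a) (b := b)).measure_lt_top⟩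
  have hm : AEStronglyMeasurable f (volume.restrict (Set.Icc a b)) := by
    have h1 : AEStronglyMeasurable f (volume.restrict (interior (Set.Icc a b))) :=
      hc.continuousOn_interior.aestronglyMeasurable isOpen_interior.measurableSet
    rwa [Measure.restrict_congr_set
      (interior_ae_eq_of_null_frontier ((convex_Icc a b).addHaar_frontier volume))] at h1
  have hP : MemLp f p (volume.restrict (Set.Icc a b)) := by
    by_cases ht : p = ∞
    · subst ht
      simp only [if_true] at hb
      refine memLp_top_of_bound hm B ?_
      filter_upwards [ae_restrict_mem measurableSet_Icc] with x hx using hb x hx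
    · simp only [ht, if_false] at hb
      refine ⟨hm, ?_⟩
      rw [eLpNorm_lt_top_iff_lintegral_rpow_enorm_lt_top hp ht]
      have e : ∀ x, ‖f x‖ₑ = ENNReal.ofReal |f x| := fun x => Real.enorm_eq_ofReal_abs _
      simp only [e]
      exact hb.trans_lt (ENNReal.rpow_lt_top_of_nonneg ENNReal.toReal_nonneg ENNReal.ofReal_ne_top)
  exact hP.mono_exponent hqp

/-- The metric entropy `log M(C_p(I, B), ε; L_q(I))`: the logarithm, `+∞` if there is no finite
cover, of the least number of closed `L_q(I)`-balls of radius `ε` (with centres anywhere in the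
space) that cover `C_p(I, B)`. -/
def convexEntropy {d : ℕ} (p q : ℝ≥0∞) [Fact (1 ≤ q)] (a b : Fin d → ℝ) (B ε : ℝ) : EReal :=
  ENNReal.log ((Metric.externalCoveringNumber ε.toNNReal
    {f : LqFun q (volume.restrict (Set.Icc a b)) | f.1 ∈ convexClass p a b B} : ℕ∞) : ℝ≥0∞)

/-- The scale `B ∏ i, (b i - a i)^{1/q - 1/p}`, where `1/∞ = 0`. -/
def entropyScale {d : ℕ} (p q : ℝ≥0∞) (a b : Fin d → ℝ) (B : ℝ) : ℝ :=
  B * ∏ i, (b i - a i) ^ ((q⁻¹).toReal - (p⁻¹).toReal)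

end

/-! Upper bound, interior. Let `f` be convex with `|f| ≤ 1` on a cube. Its Moreau envelope is
convex, and becomes concave after subtracting `|u|²/2`. On a grid of mesh `δ`, in units of `δ²`, its
second differences along the axes therefore lie in `[0, 1]`, and after rounding they take boundedly
many values. The table of rounded values is determined by these differences and `2 ^ d` initial
values, so it costs `O(δ^{-d})` bits with no logarithm on the main term. The envelope also remembers
`f`: near `u = x + s`, with `s` a subgradient at `x`, comparing envelopes compares function values,
with an error quadratic in the displacement of `u`. Mesh `δ` thus gives sup-norm error `O(δ²)` on a
smaller cube, hence entropy `η^{-d/2}` (`exists_codableBy_unitConvex`).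

Upper bound, boundary. Members of the class may blow up at the boundary, so the box is covered by
dyadic boxes at distance comparable to their side lengths from the faces. On one of relative volume
`v`, convexity and the `L_p` bound give `|f| ≲ B (|I| v)^{-1/p}` (`abs_le_of_mem_convexClass`).
Allow an error proportional to `v^{-s}` there, with `1/p < s < 1/q`. The `q`-th power of the total
error is then a multiple of `∑ v^{1-sq}` and the total entropy a multiple of `∑ v^{(s-1/p)d/2}`;
both converge exactly because `s` lies strictly between. `CodableBy.forall_tsum` joins the
infinitely many codes.

Lower bound. Raise tangent planes of a paraboloid by `δ²` at any subset of `n ^ d` grid points, `δ =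
1/(2n)`, and take the maximum. Each plane changes the function only inside its own ball of radius
`δ`, by order `δ²` on a fixed fraction of the cell. Subsets far apart in Hamming distance give
functions `δ²`-far in `L_q`, and volume counting in the Hamming cube forces `exp(c n^d)` balls
(`exp_le_externalCoveringNumber`), with `n` of order `ε^{-1/2}`. -/

/-! ### The Moreau envelope of a bounded convex function -/

/-- The Moreau envelope `u ↦ inf_{y ∈ U} (f y + |y - u|² / 2)` of `f` on `U`. -/
noncomputable def moreauEnv {ι : Type*} [Fintype ι] (U : Set (ι → ℝ)) (f : (ι → ℝ) → ℝ)
    (u : ι → ℝ) : ℝ :=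
  sInf ((fun y => f y + ∑ i, (y i - u i) ^ 2 / 2) '' U)

section Moreau

variable {ι : Type*} [Fintype ι] {U : Set (ι → ℝ)} {f g : (ι → ℝ) → ℝ}

theorem moreauEnv_le {m : ℝ} (hm : ∀ y ∈ U, m ≤ f y) (u : ι → ℝ) {y : ι → ℝ} (hy : y ∈ U) :
    moreauEnv U f u ≤ f y + ∑ i, (y i - u i) ^ 2 / 2 := by
  refine csInf_le ⟨m, ?_⟩ ⟨y, hy, rfl⟩
  rintro _ ⟨z, hz, rfl⟩
  have : 0 ≤ ∑ i, (z i - u i) ^ 2 / 2 := Finset.sum_nonneg fun i _ => by positivity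
  linarith [hm z hz]

theorem le_moreauEnv (hU : U.Nonempty) {u : ι → ℝ} {c : ℝ}
    (h : ∀ y ∈ U, c ≤ f y + ∑ i, (y i - u i) ^ 2 / 2) : c ≤ moreauEnv U f u := by
  refine le_csInf (hU.image _) ?_
  rintro _ ⟨z, hz, rfl⟩
  exact h z hz

/-- Minus `|u|²/2`, the envelope is an infimum of affine functions of `u`, hence concave; no
convexity of `f` is involved. -/
theorem moreauEnv_add_le (hU : U.Nonempty) {m : ℝ} (hm : ∀ y ∈ U, m ≤ f y) {u v w : ι → ℝ}
    (huw : ∀ i, u i + w i = 2 * v i) :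
    moreauEnv U f u + moreauEnv U f w ≤ 2 * moreauEnv U f v + ∑ i, (u i - v i) ^ 2 := by
  suffices (moreauEnv U f u + moreauEnv U f w - ∑ i, (u i - v i) ^ 2) / 2 ≤ moreauEnv U f v by
    linarith
  refine le_moreauEnv hU fun y hy => ?_
  have h1 := moreauEnv_le hm u hy
  have h2 := moreauEnv_le hm w hy
  have h3 : ∑ i, (y i - u i) ^ 2 / 2 + ∑ i, (y i - w i) ^ 2 / 2
      = 2 * (∑ i, (y i - v i) ^ 2 / 2) + ∑ i, (u i - v i) ^ 2 := by
    rw [Finset.mul_sum, ← Finset.sum_add_distrib, ← Finset.sum_add_distrib]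
    refine Finset.sum_congr rfl fun i _ => ?_
    have : w i = 2 * v i - u i := by linarith [huw i]
    rw [this]; ring
  linarith

/-- The midpoint of competitors at `u` and `w` competes at `v`: an infimal convolution of convex
functions is convex. -/
theorem two_mul_moreauEnv_le (hf : ConvexOn ℝ U f) (hU : U.Nonempty) {m : ℝ}
    (hm : ∀ y ∈ U, m ≤ f y) {u v w : ι → ℝ} (huw : ∀ i, u i + w i = 2 * v i) :
    2 * moreauEnv U f v ≤ moreauEnv U f u + moreauEnv U f w := by
  suffices 2 * moreauEnv U f v - moreauEnv U f w ≤ moreauEnv U f u by linarith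
  refine le_moreauEnv hU fun y hy => ?_
  suffices 2 * moreauEnv U f v - (f y + ∑ i, (y i - u i) ^ 2 / 2) ≤ moreauEnv U f w by linarith
  refine le_moreauEnv hU fun z hz => ?_
  have hmem := hf.1 hy hz (by norm_num : (0 : ℝ) ≤ 1 / 2) (by norm_num : (0 : ℝ) ≤ 1 / 2)
    (by norm_num)
  have hc := hf.2 hy hz (by norm_num : (0 : ℝ) ≤ 1 / 2) (by norm_num : (0 : ℝ) ≤ 1 / 2)
    (by norm_num)
  have h1 := moreauEnv_le hm v hmem
  simp only [smul_eq_mul, Pi.add_apply, Pi.smul_apply] at hc h1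
  have h3 : 2 * ∑ i, (1 / 2 * y i + 1 / 2 * z i - v i) ^ 2 / 2
      ≤ ∑ i, (y i - u i) ^ 2 / 2 + ∑ i, (z i - w i) ^ 2 / 2 := by
    rw [Finset.mul_sum, ← Finset.sum_add_distrib]
    refine Finset.sum_le_sum fun i _ => ?_
    have : w i = 2 * v i - u i := by linarith [huw i]
    rw [this]
    nlinarith [sq_nonneg ((y i - u i) - (z i - (2 * v i - u i)))]
  linarith

/-- Complete the square after replacing `f` by its affine minorant. Testing the envelope of another
`g` with `y = x` gives at most `g x + |x - u|²/2`, so envelopes at `u` control `c - g x` up to an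
error quadratic in `x + s - u`. -/
theorem sub_le_moreauEnv_of_affine_le (hU : U.Nonempty) {x s : ι → ℝ} {c : ℝ}
    (hs : ∀ y ∈ U, c + ∑ i, s i * (y i - x i) ≤ f y) (u : ι → ℝ) :
    c + ∑ i, (x i - u i) ^ 2 / 2 - ∑ i, (x i + s i - u i) ^ 2 / 2 ≤ moreauEnv U f u := by
  refine le_moreauEnv hU fun y hy => ?_
  have h : ∑ i, (x i - u i) ^ 2 / 2 ≤ ∑ i, (x i + s i - u i) ^ 2 / 2
      + ∑ i, s i * (y i - x i) + ∑ i, (y i - u i) ^ 2 / 2 := by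
    rw [← Finset.sum_add_distrib, ← Finset.sum_add_distrib]
    refine Finset.sum_le_sum fun i _ => ?_
    nlinarith [sq_nonneg (y i - u i + s i)]
  linarith [hs y hy]

/-- A continuous convex function bounded by `1` on the cube `[-1/2, 3/2]^ι` has approximate
subgradients with coordinates at most `6` at the points of `[0, 1]^ι`. -/
theorem exists_approx_subgradient
    (hf : ConvexOn ℝ (Set.Icc (fun _ : ι => (-1 / 2 : ℝ)) fun _ => 3 / 2) f)
    (hfc : ContinuousOn f (Set.Icc (fun _ : ι => (-1 / 2 : ℝ)) fun _ => 3 / 2))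
    (hb : ∀ y ∈ Set.Icc (fun _ : ι => (-1 / 2 : ℝ)) fun _ => 3 / 2, |f y| ≤ 1)
    {x : ι → ℝ} (hx : ∀ i, 0 ≤ x i ∧ x i ≤ 1) {τ : ℝ} (hτ : 0 < τ) (hτ1 : τ ≤ 1) :
    ∃ s : ι → ℝ, (∀ i, |s i| ≤ 6) ∧
      ∀ y ∈ Set.Icc (fun _ : ι => (-1 / 2 : ℝ)) fun _ => 3 / 2,
        f x - τ + ∑ i, s i * (y i - x i) ≤ f y := by
  classical
  set V := Set.Icc (fun _ : ι => (-1 / 2 : ℝ)) fun _ => 3 / 2 with hV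
  have hxV : x ∈ V := ⟨fun i => by linarith [(hx i).1], fun i => by linarith [(hx i).2]⟩
  obtain ⟨l, c, hl, hlx⟩ := ConvexOn.exists_affine_le_of_lt (𝕜 := ℝ) (s := V) (φ := f) hxV
    (show f x - τ < f x by linarith) isClosed_Icc hfc.lowerSemicontinuousOn hf
  have hle : ∀ y ∈ V, f x - τ + l (y - x) ≤ f y := fun y hy => by
    have := hl ⟨y, hy⟩
    simp only [RCLike.re_to_real, Pi.add_apply, Set.domRestrict_apply, Function.comp_apply,
      Function.const_apply] at this hlx
    rw [map_sub]; linarith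
  have hl' : ∀ z : ι → ℝ, l z = ∑ i, l (Pi.single i 1) * z i := fun z => by
    conv_lhs => rw [pi_eq_sum_univ' z]
    simp [mul_comm]
  refine ⟨fun i => l (Pi.single i 1), fun i => ?_, fun y hy => ?_⟩
  -- Moving one coordinate by at most `1/2` stays in the larger cube. With `t = ±1/2` and `τ ≤ 1`
  -- the slope is at most `2 * 3 = 6`.
  · have key : ∀ t : ℝ, |t| ≤ 1 / 2 → l (Pi.single i 1) * t ≤ 2 + τ := fun t ht => by
      have hmem : x + Pi.single i t ∈ V := by
        have h' := abs_le.1 ht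
        constructor <;> intro j <;> by_cases hj : j = i
        · subst hj; simp; linarith [(hx j).1]
        · simp [hj]; linarith [(hx j).1]
        · subst hj; simp; linarith [(hx j).2]
        · simp [hj]; linarith [(hx j).2]
      have h1 := hle _ hmem
      have h2 : l (Pi.single i t) = l (Pi.single i 1) * t := by
        rw [hl' (Pi.single i t), Finset.sum_eq_single i] <;> simp +contextual
      rw [add_sub_cancel_left, h2] at h1
      linarith [(abs_le.1 (hb _ hmem)).2, (abs_le.1 (hb _ hxV)).1]
    have h1 := key (1 / 2) (by norm_num)
    have h2 := key (-1 / 2) (by norm_num [abs_le])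
    rw [abs_le]; constructor <;> linarith
  · have := hle y hy
    rw [hl' (y - x)] at this
    simpa using this

end Moreau

/-! ### Encoding bounded convex functions on a cube -/

/-- `CodableBy 𝓕 r N` says that the members of `𝓕` can be given at most `N` labels in such a way
that any two members with the same label are related by `r`. -/
def CodableBy {X : Type*} (𝓕 : Set X) (r : X → X → Prop) (N : ℝ) : Prop :=
  ∃ (β : Type) (T : Finset β) (Φ : X → β), (∀ f ∈ 𝓕, Φ f ∈ T) ∧ (T.card : ℝ) ≤ N ∧
    ∀ f ∈ 𝓕, ∀ g ∈ 𝓕, Φ f = Φ g → r f g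

/-! ### Recovering an integer table from second differences -/

section Grid

/-- The values of `k` on `{0, 1}^ι` and, elsewhere, a second difference of `k` in one coordinate
direction. -/
noncomputable def diffCode {ι : Type*} [DecidableEq ι] (k : (ι → ℕ) → ℤ) (m : ι → ℕ) : ℤ :=
  open Classical in
  if h : ∃ i, 2 ≤ m i then
    k m - 2 * k (Function.update m h.choose (m h.choose - 1))
      + k (Function.update m h.choose (m h.choose - 2))
  else k m

theorem update_lt_of_le {ι : Type*} [DecidableEq ι] {n : ℕ} {m : ι → ℕ} (hm : ∀ i, m i < n) {j : ι} {a : ℕ} (ha : a ≤ m j)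
    (i : ι) : Function.update m j a i < n := by
  by_cases h : i = j
  · subst h; simpa using ha.trans_lt (hm i)
  · simpa [h] using hm i

variable {ι : Type*} [Fintype ι] [DecidableEq ι]

theorem sum_update_lt {m : ι → ℕ} {j : ι} {a : ℕ} (ha : a < m j) :
    ∑ i, Function.update m j a i < ∑ i, m i := by
  refine Finset.sum_lt_sum (fun i _ => ?_) ⟨j, Finset.mem_univ _, by simpa using ha⟩
  by_cases h : i = j
  · subst h; simpa using ha.le
  · simp [h]

/-- The direction of differencing depends on `m` alone, so equal codes can be solved for the value
at `m` from two points of smaller coordinate sum. -/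
theorem eq_of_diffCode_eq {n : ℕ} {k k' : (ι → ℕ) → ℤ}
    (h : ∀ m : ι → ℕ, (∀ i, m i < n) → diffCode k m = diffCode k' m) (m : ι → ℕ)
    (hm : ∀ i, m i < n) : k m = k' m := by
  induction hs : ∑ i, m i using Nat.strong_induction_on generalizing m with
  | _ s ih =>
    have hd := h m hm
    unfold diffCode at hd
    by_cases hex : ∃ i, 2 ≤ m i
    · simp only [hex, dite_true] at hd
      have h2 := hex.choose_spec
      have e1 := ih _ (hs ▸ sum_update_lt (j := hex.choose) (a := m hex.choose - 1) (by omega)) _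
        (update_lt_of_le hm (by omega)) rfl
      have e2 := ih _ (hs ▸ sum_update_lt (j := hex.choose) (a := m hex.choose - 2) (by omega)) _
        (update_lt_of_le hm (by omega)) rfl
      rw [e1, e2] at hd
      linarith
    · simpa only [hex, dite_false] using hd

/-- Only the `2 ^ d` initial points see the large alphabet `A`; this keeps `log A` off the factor `n
^ d`. -/
theorem card_piFinset_diffCode_le (n A : ℕ) (S : (ι → ℕ) → Finset ℤ)
    (hS : ∀ m, (∃ i, 2 ≤ m i) → (S m).card ≤ 6) (hS' : ∀ m, (S m).card ≤ A) (hA : 1 ≤ A) :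
    (Fintype.piFinset fun m : Fintype.piFinset fun _ : ι => Finset.range n => S m).card
      ≤ A ^ 2 ^ Fintype.card ι * 6 ^ n ^ Fintype.card ι := by
  classical
  rw [Fintype.card_piFinset]
  set box := Fintype.piFinset fun _ : ι => Finset.range n
  calc ∏ m : box, (S m).card = ∏ m ∈ box, (S m).card := Finset.prod_coe_sort box fun m => (S m).card
    _ ≤ ∏ m ∈ box, if ∃ i, 2 ≤ m i then 6 else A := by
        refine Finset.prod_le_prod' fun m _ => ?_
        split_ifs with h
        exacts [hS m h, hS' m]
    _ = 6 ^ (box.filter fun m => ∃ i, 2 ≤ m i).card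
          * A ^ (box.filter fun m => ¬ ∃ i, 2 ≤ m i).card := by
        rw [Finset.prod_ite, Finset.prod_const, Finset.prod_const]
    _ ≤ 6 ^ n ^ Fintype.card ι * A ^ 2 ^ Fintype.card ι := by
        refine Nat.mul_le_mul (Nat.pow_le_pow_right (by norm_num) ?_) (Nat.pow_le_pow_right hA ?_)
        · refine (Finset.card_filter_le _ _).trans ?_
          simp [box]
        · refine (Finset.card_le_card (t := Fintype.piFinset fun _ : ι => Finset.range 2)
            fun m hm => ?_).trans (by simp)
          simp only [Finset.mem_filter, not_exists, not_le] at hm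
          simpa using hm.2
    _ = _ := mul_comm _ _

end Grid

/-! ### Sup-norm entropy on the standard cube -/

section Cube

/-- Continuous convex functions on `[-1/2, 3/2]^ι` that are bounded by `1` there. -/
def unitConvex (ι : Type) : Set ((ι → ℝ) → ℝ) :=
  {f | ConvexOn ℝ (Set.Icc (fun _ : ι => (-1 / 2 : ℝ)) fun _ => 3 / 2) f ∧
    ContinuousOn f (Set.Icc (fun _ : ι => (-1 / 2 : ℝ)) fun _ => 3 / 2) ∧
    ∀ y ∈ Set.Icc (fun _ : ι => (-1 / 2 : ℝ)) fun _ => 3 / 2, |f y| ≤ 1}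

theorem cube_nonempty {ι : Type} :
    (Set.Icc (fun _ : ι => (-1 / 2 : ℝ)) fun _ => 3 / 2).Nonempty :=
  ⟨fun _ => 0, fun _ => by norm_num, fun _ => by norm_num⟩

variable {ι : Type} [Fintype ι]

/-- The values of the Moreau envelope at the points `-6 + δ m`, in units of `δ²`. -/
noncomputable def envCode (δ : ℝ) (f : (ι → ℝ) → ℝ) (m : ι → ℕ) : ℤ :=
  ⌊moreauEnv (Set.Icc (fun _ : ι => (-1 / 2 : ℝ)) fun _ => 3 / 2) f (fun i => -6 + δ * m i) / δ ^ 2⌋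

/-- Compare the envelopes at a grid point near `x + s`. The approximate subgradient costs `δ²`,
rounding the envelope another `δ²`, and rounding `x + s` at most `δ²` per coordinate. -/
theorem sub_le_of_envCode_eq {f g : (ι → ℝ) → ℝ} (hf : f ∈ unitConvex ι) (hg : g ∈ unitConvex ι)
    {δ : ℝ} (hδ : 0 < δ) (hδ1 : δ ≤ 1) {n : ℕ} (hn : 13 / δ < n)
    (h : ∀ m : ι → ℕ, (∀ i, m i < n) → envCode δ f m = envCode δ g m)
    {x : ι → ℝ} (hx : ∀ i, 0 ≤ x i ∧ x i ≤ 1) :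
    f x - g x ≤ (Fintype.card ι + 2) * δ ^ 2 := by
  obtain ⟨s, hs6, hs⟩ := exists_approx_subgradient hf.1 hf.2.1 hf.2.2 hx (τ := δ ^ 2)
    (by positivity) (by nlinarith)
  -- Round `x + s` down to the grid; its coordinates lie in `[-6, 7]`, whence the range `13 / δ`.
  set m : ι → ℕ := fun i => ⌊(x i + s i + 6) / δ⌋₊ with hm
  have hnn : ∀ i, 0 ≤ (x i + s i + 6) / δ := fun i =>
    div_nonneg (by linarith [(abs_le.1 (hs6 i)).1, (hx i).1]) hδ.le
  have hmn : ∀ i, m i < n := fun i => by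
    rw [hm, Nat.floor_lt (hnn i)]
    refine lt_of_le_of_lt ?_ hn
    gcongr
    linarith [(abs_le.1 (hs6 i)).2, (hx i).2]
  have hE := h m hmn
  set u : ι → ℝ := fun i => -6 + δ * m i with hu
  have hfl : moreauEnv (Set.Icc (fun _ : ι => (-1 / 2 : ℝ)) fun _ => 3 / 2) f u
      ≤ moreauEnv (Set.Icc (fun _ : ι => (-1 / 2 : ℝ)) fun _ => 3 / 2) g u + δ ^ 2 := by
    have := (abs_lt.1 (Int.abs_sub_lt_one_of_floor_eq_floor hE)).2
    rw [← sub_div, div_lt_one (by positivity)] at this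
    linarith
  have h1 := sub_le_moreauEnv_of_affine_le cube_nonempty hs u
  have hxV : x ∈ Set.Icc (fun _ : ι => (-1 / 2 : ℝ)) fun _ => 3 / 2 :=
    ⟨fun i => by linarith [(hx i).1], fun i => by linarith [(hx i).2]⟩
  have h2 := moreauEnv_le (m := -1) (fun y hy => (abs_le.1 (hg.2.2 y hy)).1) u hxV
  have h3 : ∑ i, (x i + s i - u i) ^ 2 / 2 ≤ Fintype.card ι * δ ^ 2 := by
    rw [← nsmul_eq_mul]
    refine Finset.sum_le_card_nsmul _ _ _ fun i _ => ?_
    have a1 : (m i : ℝ) * δ ≤ x i + s i + 6 := (le_div_iff₀ hδ).1 (Nat.floor_le (hnn i))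
    have a2 : x i + s i + 6 < ((m i : ℝ) + 1) * δ := (div_lt_iff₀ hδ).1 (Nat.lt_floor_add_one _)
    have a3 : 0 ≤ x i + s i - u i := by simp only [hu]; linarith
    have a4 : x i + s i - u i ≤ δ := by simp only [hu]; linarith
    nlinarith
  linarith

/-- Before rounding the second difference is in `[0, 1]`, by the two midpoint inequalities; the
floors, with weights `1, -2, 1`, move it by at most `2` either way. Hence six values. -/
theorem diffCode_envCode_mem [DecidableEq ι] {f : (ι → ℝ) → ℝ} (hf : f ∈ unitConvex ι) {δ : ℝ}
    (hδ : 0 < δ) {m : ι → ℕ} (hm : ∃ i, 2 ≤ m i) :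
    diffCode (envCode δ f) m ∈ Finset.Icc (-2 : ℤ) 3 := by
  unfold diffCode
  simp only [hm, dite_true]
  have h2 := hm.choose_spec
  set j := hm.choose
  set V := Set.Icc (fun _ : ι => (-1 / 2 : ℝ)) fun _ => 3 / 2 with hV
  have hlow : ∀ y ∈ V, -1 ≤ f y := fun y hy => (abs_le.1 (hf.2.2 y hy)).1
  set u : ι → ℝ := fun i => -6 + δ * m i with hu
  set v : ι → ℝ := fun i => -6 + δ * (Function.update m j (m j - 1) i : ℕ) with hv
  set w : ι → ℝ := fun i => -6 + δ * (Function.update m j (m j - 2) i : ℕ) with hw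
  have huw : ∀ i, u i + w i = 2 * v i := fun i => by
    by_cases h : i = j
    · subst h
      simp only [hu, hv, hw, Function.update_self]
      rw [Nat.cast_sub h2, Nat.cast_sub (by omega)]
      push_cast; ring
    · simp only [hu, hv, hw, Function.update_of_ne h]; ring
  have hsum : ∑ i, (u i - v i) ^ 2 = δ ^ 2 := by
    rw [Finset.sum_eq_single j]
    · simp only [hu, hv, Function.update_self]
      rw [Nat.cast_sub (by omega)]
      push_cast; ring
    · intro i _ h
      simp only [hu, hv, Function.update_of_ne h]; ring
    · simp
  have e1 := moreauEnv_add_le cube_nonempty hlow huw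
  have e2 := two_mul_moreauEnv_le hf.1 cube_nonempty hlow huw
  rw [hsum] at e1
  have hδ2 : 0 < δ ^ 2 := by positivity
  have e1' : moreauEnv V f u / δ ^ 2 + moreauEnv V f w / δ ^ 2
      ≤ 2 * (moreauEnv V f v / δ ^ 2) + 1 := by
    rw [← add_div, ← mul_div_assoc, ← div_self hδ2.ne', ← add_div]
    gcongr
  have e2' : 2 * (moreauEnv V f v / δ ^ 2)
      ≤ moreauEnv V f u / δ ^ 2 + moreauEnv V f w / δ ^ 2 := by
    rw [← add_div, ← mul_div_assoc]
    gcongr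
  have fu : ∀ z, ((⌊moreauEnv V f z / δ ^ 2⌋ : ℤ) : ℝ) ≤ moreauEnv V f z / δ ^ 2 :=
    fun z => Int.floor_le _
  have fl : ∀ z, moreauEnv V f z / δ ^ 2 < (⌊moreauEnv V f z / δ ^ 2⌋ : ℤ) + 1 :=
    fun z => Int.lt_floor_add_one _
  change ⌊moreauEnv V f u / δ ^ 2⌋ - 2 * ⌊moreauEnv V f v / δ ^ 2⌋ + ⌊moreauEnv V f w / δ ^ 2⌋
    ∈ Finset.Icc (-2 : ℤ) 3
  rw [Finset.mem_Icc]
  constructor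
  · have : (-2 : ℝ) ≤ ((⌊moreauEnv V f u / δ ^ 2⌋ - 2 * ⌊moreauEnv V f v / δ ^ 2⌋
        + ⌊moreauEnv V f w / δ ^ 2⌋ : ℤ) : ℝ) := by
      push_cast; linarith [fl u, fu v, fl w]
    exact_mod_cast this
  · have : ((⌊moreauEnv V f u / δ ^ 2⌋ - 2 * ⌊moreauEnv V f v / δ ^ 2⌋
        + ⌊moreauEnv V f w / δ ^ 2⌋ : ℤ) : ℝ) ≤ (3 : ℝ) := by
      push_cast; linarith [fu u, fl v, fu w]
    exact_mod_cast this

theorem envCode_mem {f : (ι → ℝ) → ℝ} (hf : f ∈ unitConvex ι) {δ : ℝ} (hδ : 0 < δ)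
    {m : ι → ℕ} (hm : ∀ i, δ * m i ≤ 15) :
    envCode δ f m ∈ Finset.Icc (⌊-1 / δ ^ 2⌋) (⌊(1 + 50 * Fintype.card ι) / δ ^ 2⌋) := by
  have hlow : ∀ y ∈ Set.Icc (fun _ : ι => (-1 / 2 : ℝ)) fun _ => 3 / 2, -1 ≤ f y :=
    fun y hy => (abs_le.1 (hf.2.2 y hy)).1
  have h0 : (fun _ => 0 : ι → ℝ) ∈ Set.Icc (fun _ : ι => (-1 / 2 : ℝ)) fun _ => 3 / 2 :=
    ⟨fun _ => by norm_num, fun _ => by norm_num⟩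
  rw [Finset.mem_Icc]
  constructor
  · refine Int.floor_le_floor (div_le_div_of_nonneg_right ?_ (by positivity))
    refine le_moreauEnv cube_nonempty fun y hy => ?_
    have := Finset.sum_nonneg fun i (_ : i ∈ Finset.univ) =>
      (by positivity : 0 ≤ (y i - (-6 + δ * m i)) ^ 2 / 2)
    linarith [hlow y hy]
  · refine Int.floor_le_floor (div_le_div_of_nonneg_right ?_ (by positivity))
    refine (moreauEnv_le hlow _ h0).trans ?_
    refine add_le_add (abs_le.1 (hf.2.2 _ h0)).2 ?_
    rw [mul_comm, ← nsmul_eq_mul]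
    refine Finset.sum_le_card_nsmul _ _ _ fun i _ => ?_
    have a1 : 0 ≤ δ * m i := by positivity
    -- The grid coordinates lie in `[-6, 9]`, so against the competitor `0` each term is at most
    -- `81/2 ≤ 50`.
    nlinarith [hm i]

theorem codableBy_unitConvex_of_mesh {δ : ℝ} (hδ : 0 < δ) (hδ1 : δ ≤ 1) :
    CodableBy (unitConvex ι)
      (fun f g => ∀ x : ι → ℝ, (∀ i, 0 ≤ x i ∧ x i ≤ 1) →
        |f x - g x| ≤ (Fintype.card ι + 2) * δ ^ 2)
      (((10 + 50 * Fintype.card ι) / δ ^ 2) ^ 2 ^ Fintype.card ι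
        * 6 ^ ⌊15 / δ⌋₊ ^ Fintype.card ι) := by
  classical
  set n := ⌊15 / δ⌋₊ with hn
  set A : Finset ℤ := Finset.Icc (⌊-1 / δ ^ 2⌋) (⌊(1 + 50 * (Fintype.card ι : ℝ)) / δ ^ 2⌋) with hA
  set S : (ι → ℕ) → Finset ℤ := fun m => if ∃ i, 2 ≤ m i then Finset.Icc (-2 : ℤ) 3 else A with hS
  have hδ2 : 0 < δ ^ 2 := by positivity
  have hδ2' : 1 ≤ 1 / δ ^ 2 := (one_le_div hδ2).2 (by nlinarith)
  have hA' : (A.card : ℝ) ≤ (4 + 50 * Fintype.card ι) / δ ^ 2 := by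
    have h1 := Int.lt_floor_add_one (-1 / δ ^ 2)
    have h2 := Int.floor_le ((1 + 50 * (Fintype.card ι : ℝ)) / δ ^ 2)
    have h4 : (⌊-1 / δ ^ 2⌋ : ℤ) ≤ ⌊(1 + 50 * (Fintype.card ι : ℝ)) / δ ^ 2⌋ + 1 := by
      have : ⌊-1 / δ ^ 2⌋ ≤ ⌊(1 + 50 * (Fintype.card ι : ℝ)) / δ ^ 2⌋ := by
        refine Int.floor_le_floor (div_le_div_of_nonneg_right ?_ hδ2.le)
        have : (0 : ℝ) ≤ Fintype.card ι := by positivity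
        linarith
      omega
    have h3 : (A.card : ℝ) = ((⌊(1 + 50 * (Fintype.card ι : ℝ)) / δ ^ 2⌋ + 1
        - ⌊-1 / δ ^ 2⌋ : ℤ) : ℝ) := by
      rw [hA, Int.card_Icc, ← Int.cast_natCast, Int.toNat_of_nonneg (by linarith)]
    rw [h3]
    push_cast
    have h5 : (4 + 50 * (Fintype.card ι : ℝ)) / δ ^ 2
        = (1 + 50 * (Fintype.card ι : ℝ)) / δ ^ 2 - (-1 / δ ^ 2) + 2 * (1 / δ ^ 2) := by ring
    linarith
  refine ⟨(Fintype.piFinset fun _ : ι => Finset.range n) → ℤ, 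
    Fintype.piFinset fun m : Fintype.piFinset fun _ : ι => Finset.range n => S m,
    fun f m => diffCode (envCode δ f) m, ?_, ?_, ?_⟩
  · intro f hf
    rw [Fintype.mem_piFinset]
    rintro ⟨m, hm⟩
    simp only [Fintype.mem_piFinset, Finset.mem_range] at hm
    simp only [hS]
    split_ifs with h
    · exact diffCode_envCode_mem hf hδ h
    · rw [diffCode, dif_neg h]
      refine envCode_mem hf hδ fun i => ?_
      have h1 : (m i : ℝ) ≤ n := by exact_mod_cast (hm i).le
      have h2 : (n : ℝ) ≤ 15 / δ := Nat.floor_le (by positivity)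
      rw [mul_comm]
      exact (le_div_iff₀ hδ).1 (h1.trans h2)
  · have := card_piFinset_diffCode_le n (A.card + 6) S (fun m hm => by simp [hS, hm])
      (fun m => by simp only [hS]; split_ifs <;> simp) (by omega)
    calc _ ≤ (((A.card + 6) ^ 2 ^ Fintype.card ι * 6 ^ n ^ Fintype.card ι : ℕ) : ℝ) := by
            exact_mod_cast this
      _ ≤ _ := by
        push_cast
        gcongr
        have : (10 + 50 * (Fintype.card ι : ℝ)) / δ ^ 2
          = (4 + 50 * (Fintype.card ι : ℝ)) / δ ^ 2 + 6 * (1 / δ ^ 2) := by ring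
        linarith
  · intro f hf g hg hfg x hx
    have hcode : ∀ m : ι → ℕ, (∀ i, m i < n) → envCode δ f m = envCode δ g m := by
      refine eq_of_diffCode_eq fun m hm => ?_
      exact congrFun hfg ⟨m, by simpa using hm⟩
    -- The range `15 / δ` leaves room for the floor, since `2 / δ ≥ 2`.
    have hn' : 13 / δ < n := by
      have h1 := Nat.lt_floor_add_one (15 / δ)
      have h2 : 1 ≤ 1 / δ := (one_le_div hδ).2 hδ1
      have h3 : 15 / δ = 13 / δ + 2 * (1 / δ) := by ring
      rw [← hn] at h1
      linarith
    rw [abs_le]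
    constructor
    · linarith [sub_le_of_envCode_eq hg hf hδ hδ1 hn' (fun m hm => (hcode m hm).symm) hx]
    · exact sub_le_of_envCode_eq hf hg hδ hδ1 hn' hcode hx

/-- Bounded convex functions on a cube have metric entropy of order `η ^ (-d / 2)` in the supremum
norm on a smaller cube. -/
theorem exists_codableBy_unitConvex [Nonempty ι] :
    ∃ C : ℝ, 0 < C ∧ ∀ η : ℝ, 0 < η →
      CodableBy (unitConvex ι)
        (fun f g => ∀ x : ι → ℝ, (∀ i, 0 ≤ x i ∧ x i ≤ 1) → |f x - g x| ≤ η)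
        (Real.exp (C * η ^ (-(Fintype.card ι : ℝ) / 2))) := by
  set d := Fintype.card ι with hd
  have hd1 : 1 ≤ d := Fintype.card_pos
  set K : ℝ := 2 ^ d * (2 * √(10 + 50 * d)) + 15 ^ d * Real.log 6 with hK
  have hKpos : 0 < K := by
    have : 0 < Real.log 6 := Real.log_pos (by norm_num)
    positivity
  refine ⟨K * ((d : ℝ) + 2) ^ ((d : ℝ) / 2), by positivity, fun η hη => ?_⟩
  -- Functions bounded by `1` differ by at most `2`, so one label suffices here.
  by_cases hη2 : 2 ≤ η
  · refine ⟨Unit, Finset.univ, fun _ => (), by simp, ?_, fun f hf g hg _ x hx => ?_⟩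
    · simp only [Finset.card_univ, Fintype.card_unit, Nat.cast_one]
      exact Real.one_le_exp (by positivity)
    · have hxV : x ∈ Set.Icc (fun _ : ι => (-1 / 2 : ℝ)) fun _ => 3 / 2 :=
        ⟨fun i => by linarith [(hx i).1], fun i => by linarith [(hx i).2]⟩
      have h1 := abs_le.1 (hf.2.2 x hxV)
      have h2 := abs_le.1 (hg.2.2 x hxV)
      rw [abs_le]; constructor <;> linarith
  push Not at hη2
  set δ := √(η / (d + 2)) with hδdef
  have hδ : 0 < δ := Real.sqrt_pos.2 (by positivity)
  have hδsq : δ ^ 2 = η / (d + 2) := Real.sq_sqrt (by positivity)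
  have hδ1 : δ ≤ 1 := by
    rw [hδdef, Real.sqrt_le_one, div_le_one (by positivity)]
    have : (0 : ℝ) ≤ d := by positivity
    linarith
  obtain ⟨β, T, Φ, h1, h2, h3⟩ := codableBy_unitConvex_of_mesh (ι := ι) hδ hδ1
  refine ⟨β, T, Φ, h1, h2.trans ?_, fun f hf g hg hfg x hx => (h3 f hf g hg hfg x hx).trans ?_⟩
  · have hpow : K * ((d : ℝ) + 2) ^ ((d : ℝ) / 2) * η ^ (-(d : ℝ) / 2) = K * (1 / δ) ^ d := by
      rw [mul_assoc]
      congr 1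
      have : (1 / δ) = (η / (d + 2)) ^ (-(1 : ℝ) / 2) := by
        rw [hδdef, Real.sqrt_eq_rpow, neg_div, Real.rpow_neg (by positivity), one_div]
      rw [this, ← Real.rpow_natCast, ← Real.rpow_mul (by positivity),
        Real.div_rpow hη.le (by positivity)]
      rw [show -(1 : ℝ) / 2 * d = -(d : ℝ) / 2 by ring, show -(d : ℝ) / 2 = -((d : ℝ) / 2) by ring,
        Real.rpow_neg (x := (d : ℝ) + 2) (by positivity)]
      field_simp
    rw [hpow, ← Real.log_le_iff_le_exp (by positivity), Real.log_mul (by positivity) (by positivity),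
      Real.log_pow, Real.log_pow]
    have hδinv : 1 ≤ 1 / δ := (one_le_div hδ).2 hδ1
    -- The initial values cost only `log (1 / δ)`, absorbed into `δ^{-d}` through `log t ≤ t` and `d
    -- ≥ 1`.
    have hlog : Real.log ((10 + 50 * d) / δ ^ 2) ≤ 2 * √(10 + 50 * d) * (1 / δ) ^ d := by
      have e : (10 + 50 * (d : ℝ)) / δ ^ 2 = (√(10 + 50 * d) * (1 / δ)) ^ 2 := by
        rw [mul_pow, Real.sq_sqrt (by positivity : (0 : ℝ) ≤ 10 + 50 * d)]; ring
      rw [e, Real.log_pow]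
      push_cast
      rw [mul_assoc]
      gcongr
      refine (Real.log_le_self (by positivity)).trans ?_
      gcongr
      exact le_self_pow₀ hδinv (by omega)
    have hn : ((⌊15 / δ⌋₊ ^ d : ℕ) : ℝ) ≤ 15 ^ d * (1 / δ) ^ d := by
      push_cast
      rw [← mul_pow]
      gcongr
      rw [mul_one_div]
      exact Nat.floor_le (by positivity)
    have hl6 : 0 < Real.log 6 := Real.log_pos (by norm_num)
    calc _ ≤ ((2 ^ d : ℕ) : ℝ) * (2 * √(10 + 50 * d) * (1 / δ) ^ d)
          + 15 ^ d * (1 / δ) ^ d * Real.log 6 := by gcongr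
      _ = _ := by push_cast; rw [hK]; ring
  · rw [hδsq]; field_simp; rfl

end Cube

/-! ### Members of `convexClass` on a box well inside the domain -/

section Bound

variable {d : ℕ} {p : ℝ≥0∞} {a b : Fin d → ℝ} {B : ℝ} {f : (Fin d → ℝ) → ℝ}

/-- Union bound: each of the three conditions excludes a set of `y` of measure at most that of `A`,
by translation, reflection or contraction. -/
theorem exists_good_direction {d : ℕ} (A : Set (Fin d → ℝ)) (x h : Fin d → ℝ)
    (hA : 3 * volume A < volume (Set.Icc (-h) h)) :
    ∃ y ∈ Set.Icc (-h) h, x + y ∉ A ∧ x - y ∉ A ∧ x + (2 : ℝ) • y ∉ A := by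
  by_contra! hcon
  refine hA.not_ge ?_
  have hsub : Set.Icc (-h) h ⊆ ((fun y => x + y) ⁻¹' A ∪ (fun y => x - y) ⁻¹' A)
      ∪ ((2 : ℝ) • ·) ⁻¹' ((fun y => x + y) ⁻¹' A) := fun y hy => by
    by_cases h1 : x + y ∈ A
    · exact Or.inl (Or.inl h1)
    by_cases h2 : x - y ∈ A
    · exact Or.inl (Or.inr h2)
    exact Or.inr (hcon y hy h1 h2)
  refine (measure_mono hsub).trans ((measure_union_le _ _).trans ?_)
  refine (add_le_add_left (measure_union_le _ _) _).trans ?_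
  have e1 : volume ((fun y => x + y) ⁻¹' A) = volume A := measure_preimage_add _ _ _
  have e2 : volume ((fun y => x - y) ⁻¹' A) = volume A :=
    MeasurePreserving.measure_preimage_equiv (f := MeasurableEquiv.subLeft x)
      (Measure.measurePreserving_sub_left volume x) A
  have e3 : volume (((2 : ℝ) • ·) ⁻¹' ((fun y => x + y) ⁻¹' A)) ≤ volume A := by
    rw [Measure.addHaar_preimage_smul _ (by norm_num), e1]
    refine mul_le_of_le_one_left' ?_
    rw [ENNReal.ofReal_le_one, abs_of_nonneg (by positivity)]
    exact inv_le_one_of_one_le₀ (one_le_pow₀ (by norm_num))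
  calc _ ≤ volume A + volume A + volume A := by rw [e1, e2]; gcongr
    _ = 3 * volume A := by ring

/-- By Chebyshev, `|f| ≥ t` only on a set of measure at most `v / 4`, so some `y` makes `x + y`, `x
- y`, `x + 2y` all good. Convexity gives `f x ≤ t` from the first two, and `f x ≥ 2 f (x + y) - f (x
+ 2y) ≥ -3t`. -/
theorem abs_le_of_mem_convexClass (hp : p ≠ 0) (hB : 0 < B) (hf : f ∈ convexClass p a b B)
    {x h : Fin d → ℝ} (hh : ∀ i, 0 < h i) (hxl : ∀ i, a i ≤ x i - 2 * h i)
    (hxr : ∀ i, x i + 2 * h i ≤ b i) :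
    |f x| ≤ 3 * (B * (4 / ∏ i, (2 * h i)) ^ (p⁻¹).toReal) := by
  have hxI : x ∈ Set.Icc a b :=
    ⟨fun i => by linarith [hxl i, hh i], fun i => by linarith [hxr i, hh i]⟩
  by_cases ht : p = ∞
  · subst ht
    have := hf.2
    simp only [if_true] at this
    simp only [ENNReal.inv_top, ENNReal.toReal_zero, Real.rpow_zero, mul_one]
    linarith [this x hxI]
  have hb := hf.2
  simp only [ht, if_false] at hb
  have hp' : 0 < p.toReal := ENNReal.toReal_pos hp ht
  set v : ℝ := ∏ i, (2 * h i) with hv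
  have hvpos : 0 < v := Finset.prod_pos fun i _ => by linarith [hh i]
  set t : ℝ := B * (4 / v) ^ (p⁻¹).toReal with htdef
  have htpos : 0 < t := by positivity
  have htp : t ^ p.toReal = B ^ p.toReal * (4 / v) := by
    rw [htdef, Real.mul_rpow hB.le (by positivity), ← Real.rpow_mul (by positivity),
      ENNReal.toReal_inv, inv_mul_cancel₀ hp'.ne', Real.rpow_one]
  set A : Set (Fin d → ℝ) :=
    {z | ENNReal.ofReal t ^ p.toReal ≤ ENNReal.ofReal |f z| ^ p.toReal} ∩ Set.Icc a b with hA
  have hmeas : AEMeasurable (fun z => ENNReal.ofReal |f z| ^ p.toReal)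
      (volume.restrict (Set.Icc a b)) := by
    have := (memLp_of_mem_convexClass hp le_rfl hf).1.aemeasurable
    exact (ENNReal.measurable_ofReal.comp_aemeasurable this.abs).pow_const _
  have hche := (mul_meas_ge_le_lintegral₀ hmeas (ENNReal.ofReal t ^ p.toReal)).trans hb
  rw [Measure.restrict_apply' measurableSet_Icc, ← hA, ENNReal.ofReal_rpow_of_pos htpos,
    ENNReal.ofReal_rpow_of_pos hB, htp, ENNReal.ofReal_mul (by positivity), mul_assoc] at hche
  have hche' : ENNReal.ofReal (4 / v) * volume A ≤ 1 := by
    have h0 : ENNReal.ofReal (B ^ p.toReal) ≠ 0 := by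
      rw [Ne, ENNReal.ofReal_eq_zero, not_le]; positivity
    rw [← ENNReal.mul_le_mul_iff_right h0 ENNReal.ofReal_ne_top]
    simpa using hche
  have hvol : volume (Set.Icc (-h) h) = ENNReal.ofReal v := by
    rw [Real.volume_Icc_pi, hv, ENNReal.ofReal_prod_of_nonneg fun i _ => by linarith [hh i]]
    refine Finset.prod_congr rfl fun i _ => ?_
    congr 1
    simp only [Pi.neg_apply]; ring
  have hsmall : 3 * volume A < volume (Set.Icc (-h) h) := by
    rw [hvol]
    have hAle : volume A ≤ ENNReal.ofReal (v / 4) := by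
      have h1 : ENNReal.ofReal (v / 4) * (ENNReal.ofReal (4 / v) * volume A)
          ≤ ENNReal.ofReal (v / 4) * 1 := by gcongr
      rw [← mul_assoc, ← ENNReal.ofReal_mul (by positivity), mul_one] at h1
      rwa [show v / 4 * (4 / v) = 1 by field_simp, ENNReal.ofReal_one, one_mul] at h1
    calc 3 * volume A ≤ 3 * ENNReal.ofReal (v / 4) := by gcongr
      _ = ENNReal.ofReal (3 * (v / 4)) := by
        rw [ENNReal.ofReal_mul (by norm_num)]; norm_num
      _ < _ := (ENNReal.ofReal_lt_ofReal_iff hvpos).2 (by linarith)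
  obtain ⟨y, hy, h1, h2, h3⟩ := exists_good_direction A x h hsmall
  have hgood : ∀ z ∈ Set.Icc a b, z ∉ A → |f z| ≤ t := fun z hz hzA => by
    by_contra hlt
    push Not at hlt
    exact hzA ⟨ENNReal.rpow_le_rpow (ENNReal.ofReal_le_ofReal hlt.le) hp'.le, hz⟩
  have hyb : ∀ i, -h i ≤ y i ∧ y i ≤ h i := fun i => ⟨hy.1 i, hy.2 i⟩
  have m1 : x + y ∈ Set.Icc a b := ⟨fun i => by
    simp only [Pi.add_apply]; linarith [hxl i, hh i, hyb i], fun i => by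
    simp only [Pi.add_apply]; linarith [hxr i, hh i, hyb i]⟩
  have m2 : x - y ∈ Set.Icc a b := ⟨fun i => by
    simp only [Pi.sub_apply]; linarith [hxl i, hh i, hyb i], fun i => by
    simp only [Pi.sub_apply]; linarith [hxr i, hh i, hyb i]⟩
  have m3 : x + (2 : ℝ) • y ∈ Set.Icc a b := ⟨fun i => by
    simp only [Pi.add_apply, Pi.smul_apply, smul_eq_mul]; linarith [hxl i, hh i, hyb i], fun i => by
    simp only [Pi.add_apply, Pi.smul_apply, smul_eq_mul]; linarith [hxr i, hh i, hyb i]⟩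
  have g1 := abs_le.1 (hgood _ m1 h1)
  have g2 := abs_le.1 (hgood _ m2 h2)
  have g3 := abs_le.1 (hgood _ m3 h3)
  have c1 := hf.1.2 m1 m2 (by norm_num : (0 : ℝ) ≤ 1 / 2) (by norm_num : (0 : ℝ) ≤ 1 / 2)
    (by norm_num)
  have c2 := hf.1.2 hxI m3 (by norm_num : (0 : ℝ) ≤ 1 / 2) (by norm_num : (0 : ℝ) ≤ 1 / 2)
    (by norm_num)
  rw [show (1 / 2 : ℝ) • (x + y) + (1 / 2 : ℝ) • (x - y) = x by module] at c1
  rw [show (1 / 2 : ℝ) • x + (1 / 2 : ℝ) • (x + (2 : ℝ) • y) = x + y by module] at c2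
  simp only [smul_eq_mul] at c1 c2
  rw [abs_le]
  constructor <;> linarith

/-- The rescaling of a member of `convexClass` from a box well inside the domain to the standard
cube. -/
theorem rescale_mem_unitConvex (hp : p ≠ 0) (hB : 0 < B) (hf : f ∈ convexClass p a b B)
    {α l : Fin d → ℝ} (hl : ∀ i, 0 < l i) (hal : ∀ i, a i ≤ α i - l i)
    (hbl : ∀ i, α i + 2 * l i ≤ b i) :
    (fun t : Fin d → ℝ => f (fun i => α i + l i * t i)
      / (3 * (B * (4 / ∏ i, (l i / 2)) ^ (p⁻¹).toReal))) ∈ unitConvex (Fin d) := by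
  have hprod : 0 < ∏ i, (l i / 2) := Finset.prod_pos fun i _ => by linarith [hl i]
  set M := 3 * (B * (4 / ∏ i, (l i / 2)) ^ (p⁻¹).toReal) with hM
  have hMpos : 0 < M := by positivity
  set V := Set.Icc (fun _ : Fin d => (-1 / 2 : ℝ)) fun _ => 3 / 2
  have hbd : ∀ t ∈ V, (∀ i, a i + l i / 2 ≤ α i + l i * t i) ∧
      ∀ i, α i + l i * t i + l i / 2 ≤ b i := fun t ht =>
    ⟨fun i => by nlinarith [ht.1 i, hl i, hal i], fun i => by nlinarith [ht.2 i, hl i, hbl i]⟩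
  -- Continuity is available only in the interior: a convex function may jump at the boundary.
  have hI : ∀ t ∈ V, (fun i => α i + l i * t i) ∈ interior (Set.Icc a b) := fun t ht => by
    refine mem_interior.2 ⟨Set.univ.pi fun i => Set.Ioo (a i) (b i), ?_,
      isOpen_set_pi Set.finite_univ fun i _ => isOpen_Ioo, fun i _ => ?_⟩
    · exact fun y hy => ⟨fun i => (hy i trivial).1.le, fun i => (hy i trivial).2.le⟩
    · exact ⟨by linarith [(hbd t ht).1 i, hl i], by linarith [(hbd t ht).2 i, hl i]⟩
  refine ⟨⟨convex_Icc _ _, fun s hs t ht c e hc he hce => ?_⟩, ?_, fun t ht => ?_⟩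
  · have := hf.1.2 (interior_subset (hI s hs)) (interior_subset (hI t ht)) hc he hce
    have hpt : (fun i => α i + l i * (c • s + e • t) i)
        = c • (fun i => α i + l i * s i) + e • (fun i => α i + l i * t i) := by
      funext i
      simp only [Pi.add_apply, Pi.smul_apply, smul_eq_mul]
      linear_combination -(α i) * hce
    simp only [hpt]
    simp only [smul_eq_mul] at this ⊢
    rw [← mul_div_assoc, ← mul_div_assoc, ← add_div]
    gcongr
  · refine ContinuousOn.div_const ?_ _
    exact hf.1.continuousOn_interior.comp (by fun_prop) fun t ht => hI t ht
  · rw [abs_div, abs_of_pos hMpos, div_le_one hMpos]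
    -- The image of the cube keeps distance `l / 2 = 2h` from the faces when `h = l / 4`.
    have := abs_le_of_mem_convexClass hp hB hf (x := fun i => α i + l i * t i)
      (h := fun i => l i / 4) (fun i => by linarith [hl i])
      (fun i => by linarith [(hbd t ht).1 i]) (fun i => by linarith [(hbd t ht).2 i])
    refine this.trans (le_of_eq ?_)
    rw [hM]
    congr 5
    funext i
    ring

theorem codableBy_convexClass_box {C : ℝ}
    (hC : ∀ η : ℝ, 0 < η → CodableBy (unitConvex (Fin d))
      (fun f g => ∀ x : Fin d → ℝ, (∀ i, 0 ≤ x i ∧ x i ≤ 1) → |f x - g x| ≤ η)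
      (Real.exp (C * η ^ (-(d : ℝ) / 2))))
    (hp : p ≠ 0) (hB : 0 < B) {α l : Fin d → ℝ} (hl : ∀ i, 0 < l i)
    (hal : ∀ i, a i ≤ α i - l i) (hbl : ∀ i, α i + 2 * l i ≤ b i) {ρ : ℝ} (hρ : 0 < ρ) :
    CodableBy (convexClass p a b B)
      (fun f g => ∀ x ∈ Set.Icc α (α + l), |f x - g x| ≤ ρ)
      (Real.exp (C * (ρ / (3 * (B * (4 / ∏ i, (l i / 2)) ^ (p⁻¹).toReal))) ^ (-(d : ℝ) / 2))) := by
  have hprod : 0 < ∏ i, (l i / 2) := Finset.prod_pos fun i _ => by linarith [hl i]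
  have hmem := fun f hf => rescale_mem_unitConvex (f := f) hp hB hf hl hal hbl
  set M := 3 * (B * (4 / ∏ i, (l i / 2)) ^ (p⁻¹).toReal) with hM
  have hMpos : 0 < M := by positivity
  obtain ⟨β, T, Φ, h1, h2, h3⟩ := hC (ρ / M) (by positivity)
  refine ⟨β, T, fun f => Φ fun t : Fin d → ℝ => f (fun i => α i + l i * t i) / M,
    fun f hf => h1 _ (hmem f hf), h2, fun f hf g hg hfg x hx => ?_⟩
  have := h3 _ (hmem f hf) _ (hmem g hg) hfg (fun i => (x i - α i) / l i) fun i => by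
    have e1 := hx.1 i
    have e2 := hx.2 i
    simp only [Pi.add_apply] at e2
    exact ⟨div_nonneg (by linarith) (hl i).le, (div_le_one (hl i)).2 (by linarith)⟩
  have hxe : (fun i => α i + l i * ((x i - α i) / l i)) = x := by
    funext i
    rw [mul_div_cancel₀ _ (hl i).ne']; ring
  simp only [hxe] at this
  rw [← sub_div, abs_div, abs_of_pos hMpos] at this
  exact (div_le_div_iff_of_pos_right hMpos).1 this

end Bound

/-! ### Combining codes -/

/-- By summability all but finitely many codes have fewer than two labels. Such a code already
relates all members, so only the finitely many others need recording. -/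
theorem CodableBy.forall_tsum {X K : Type} {𝓕 : Set X} {r : K → X → X → Prop} {x : K → ℝ}
    (hx : Summable x) (hx0 : ∀ k, 0 ≤ x k) (h : ∀ k, CodableBy 𝓕 (r k) (Real.exp (x k))) :
    CodableBy 𝓕 (fun f g => ∀ k, r k f g) (Real.exp (∑' k, x k)) := by
  classical
  choose β T Φ h1 h2 h3 using h
  have hfin : {k | ¬ x k < Real.log 2}.Finite :=
    hx.tendsto_cofinite_zero.eventually_lt_const (Real.log_pos (by norm_num))
  set F := hfin.toFinset with hF
  refine ⟨(k : F) → β k, Fintype.piFinset fun k : F => T k, fun f k => Φ k f, fun f hf => ?_, ?_,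
    fun f hf g hg hfg k => ?_⟩
  · rw [Fintype.mem_piFinset]
    exact fun k => h1 k f hf
  · rw [Fintype.card_piFinset, Nat.cast_prod]
    calc ∏ k : F, ((T k).card : ℝ) ≤ ∏ k : F, Real.exp (x k) :=
          Finset.prod_le_prod (fun k _ => by positivity) fun k _ => h2 k
      _ = ∏ k ∈ F, Real.exp (x k) := Finset.prod_coe_sort F fun k => Real.exp (x k)
      _ = Real.exp (∑ k ∈ F, x k) := (Real.exp_sum _ _).symm
      _ ≤ _ := Real.exp_le_exp.2 (hx.sum_le_tsum _ fun k _ => hx0 k)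
  · by_cases hk : k ∈ F
    · exact h3 k f hf g hg (congrFun hfg ⟨k, hk⟩)
    · have hlt : x k < Real.log 2 := by
        by_contra hcon
        exact hk (hfin.mem_toFinset.2 hcon)
      have hcard : ((T k).card : ℝ) < 2 := by
        refine (h2 k).trans_lt ?_
        rwa [← Real.lt_log_iff_exp_lt (by norm_num)]
      have hcard' : (T k).card ≤ 1 := by
        have : (T k).card < 2 := by exact_mod_cast hcard
        omega
      exact h3 k f hf g hg (Finset.card_le_one.1 hcard' _ (h1 k f hf) _ (h1 k g hg))

theorem CodableBy.externalCoveringNumber_le {X : Type*} [PseudoEMetricSpace X] {A : Set X}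
    {ε : NNReal} {N : ℝ} (h : CodableBy A (fun f g => edist f g ≤ ε) N) :
    ((Metric.externalCoveringNumber ε A : ℕ∞) : ℝ≥0∞) ≤ ENNReal.ofReal N := by
  classical
  obtain ⟨β, T, Φ, h1, h2, h3⟩ := h
  by_cases hA : A.Nonempty
  · obtain ⟨f₀, hf₀⟩ := hA
    -- One member per label serves as a centre; unused labels get the default `f₀`.
    have hrep : ∀ t : β, ∃ f : X, (∃ g ∈ A, Φ g = t) → f ∈ A ∧ Φ f = t := fun t => by
      by_cases ht : ∃ g ∈ A, Φ g = t
      · obtain ⟨g, hg, hgt⟩ := ht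
        exact ⟨g, fun _ => ⟨hg, hgt⟩⟩
      · exact ⟨f₀, fun h => absurd h ht⟩
    choose R hR using hrep
    have hcov : Metric.IsCover ε A (R '' (T : Set β)) := fun f hf => by
      obtain ⟨hmem, heq⟩ := hR (Φ f) ⟨f, hf, rfl⟩
      exact ⟨R (Φ f), ⟨Φ f, h1 f hf, rfl⟩, h3 f hf _ hmem heq.symm⟩
    have hle : Metric.externalCoveringNumber ε A ≤ (T.card : ℕ∞) :=
      hcov.externalCoveringNumber_le_encard.trans
        ((Set.encard_image_le _ _).trans (Set.encard_coe_eq_coe_finsetCard T).le)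
    calc ((Metric.externalCoveringNumber ε A : ℕ∞) : ℝ≥0∞) ≤ ((T.card : ℕ∞) : ℝ≥0∞) := by
          exact_mod_cast hle
      _ = ENNReal.ofReal (T.card : ℝ) := by simp
      _ ≤ _ := ENNReal.ofReal_le_ofReal h2
  · rw [Set.not_nonempty_iff_eq_empty] at hA
    subst hA
    simp

/-! ### A dyadic decomposition of the unit interval -/

/-- The length of the dyadic interval with index `j`. -/
noncomputable def dyadicLen (j : ℕ × Bool) : ℝ := 1 / 4 * (1 / 2) ^ j.1

/-- The left end point of the dyadic interval with index `j`; the intervals accumulate at `0` for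
`j.2 = false` and at `1` for `j.2 = true`. -/
noncomputable def dyadicLeft (j : ℕ × Bool) : ℝ :=
  if j.2 then 1 - 2 * dyadicLen j else dyadicLen j

theorem dyadicLen_pos (j : ℕ × Bool) : 0 < dyadicLen j := by unfold dyadicLen; positivity

theorem dyadicLen_le (j : ℕ × Bool) : dyadicLen j ≤ 1 / 4 := by
  unfold dyadicLen
  have : (1 / 2 : ℝ) ^ j.1 ≤ 1 := pow_le_one₀ (by norm_num) (by norm_num)
  linarith

/-- With `dyadicLeft_add_le`, the Whitney property: each interval keeps at least its own length from
both ends of `[0, 1]`, the margin that rescaling to the cube needs. -/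
theorem dyadicLen_le_dyadicLeft (j : ℕ × Bool) : dyadicLen j ≤ dyadicLeft j := by
  unfold dyadicLeft
  split_ifs
  · linarith [dyadicLen_le j]
  · exact le_rfl

theorem dyadicLeft_add_le (j : ℕ × Bool) : dyadicLeft j + 2 * dyadicLen j ≤ 1 := by
  unfold dyadicLeft
  split_ifs
  · linarith
  · linarith [dyadicLen_le j]

theorem exists_dyadic_mem {x : ℝ} (h0 : 0 < x) (h1 : x < 1) :
    ∃ j : ℕ × Bool, dyadicLeft j ≤ x ∧ x ≤ dyadicLeft j + dyadicLen j := by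
  have key : ∀ y : ℝ, 0 < y → y ≤ 1 / 2 →
      ∃ n : ℕ, 1 / 4 * (1 / 2) ^ n ≤ y ∧ y ≤ 2 * (1 / 4 * (1 / 2 : ℝ) ^ n) := fun y hy hy2 => by
    obtain ⟨n, hn1, hn2⟩ := exists_nat_pow_near_of_lt_one (x := 2 * y) (y := (1 / 2 : ℝ))
      (by linarith) (by linarith) (by norm_num) (by norm_num)
    refine ⟨n, ?_, by linarith⟩
    rw [pow_succ] at hn1
    linarith
  rcases le_total x (1 / 2) with h | h
  · obtain ⟨n, hn1, hn2⟩ := key x h0 h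
    refine ⟨(n, false), ?_, ?_⟩ <;> simp only [dyadicLeft, dyadicLen, Bool.false_eq_true, if_false]
    · exact hn1
    · linarith
  · obtain ⟨n, hn1, hn2⟩ := key (1 - x) (by linarith) (by linarith)
    refine ⟨(n, true), ?_, ?_⟩ <;> simp only [dyadicLeft, dyadicLen, if_true]
    · linarith
    · linarith

theorem summable_dyadicLen_rpow {t : ℝ} (ht : 0 < t) : Summable fun j => dyadicLen j ^ t := by
  have h1 : Summable fun n : ℕ => (1 / 4 : ℝ) ^ t * ((1 / 2 : ℝ) ^ t) ^ n :=
    (summable_geometric_of_lt_one (by positivity)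
      (Real.rpow_lt_one (by norm_num) (by norm_num) ht)).mul_left _
  have h2 := h1.mul_of_nonneg (Summable.of_finite (f := fun _ : Bool => (1 : ℝ)))
    (fun n => by positivity) (fun _ => by norm_num)
  refine h2.congr fun j => ?_
  simp only [dyadicLen, mul_one]
  rw [Real.mul_rpow (by norm_num) (by positivity), ← Real.rpow_natCast, ← Real.rpow_natCast,
    ← Real.rpow_mul (by norm_num), ← Real.rpow_mul (by norm_num), mul_comm t]

theorem summable_fin_prod_of_nonneg {J : Type*} {f : J → ℝ} (hf : Summable f) (h0 : ∀ j, 0 ≤ f j)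
    (d : ℕ) : Summable fun k : Fin d → J => ∏ i, f (k i) := by
  induction d with
  | zero => exact Summable.of_finite
  | succ d ih =>
    have h := hf.mul_of_nonneg ih h0 fun k => Finset.prod_nonneg fun i _ => h0 _
    rw [← (Fin.consEquiv fun _ : Fin (d + 1) => J).summable_iff]
    refine h.congr fun k => ?_
    simp [Fin.prod_univ_succ, Fin.consEquiv]

/-- The volume of the dyadic box with index `k`. -/
noncomputable def dyadicVol {d : ℕ} (k : Fin d → ℕ × Bool) : ℝ := ∏ i, dyadicLen (k i)

theorem dyadicVol_pos {d : ℕ} (k : Fin d → ℕ × Bool) : 0 < dyadicVol k :=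
  Finset.prod_pos fun _ _ => dyadicLen_pos _

/-- The sum factors into geometric series. It is used for both the error and the entropy exponent.
-/
theorem summable_dyadicVol_rpow (d : ℕ) {t : ℝ} (ht : 0 < t) :
    Summable fun k : Fin d → ℕ × Bool => dyadicVol k ^ t := by
  refine (summable_fin_prod_of_nonneg (summable_dyadicLen_rpow ht)
    (fun j => Real.rpow_nonneg (dyadicLen_pos j).le t) d).congr fun k => ?_
  exact Real.finsetProd_rpow _ _ (fun i _ => (dyadicLen_pos _).le) t

section Box

variable {d : ℕ} {a b : Fin d → ℝ}

/-- The lower corner of the dyadic box with index `k` in `∏ i, [a i, b i]`. -/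
noncomputable def dyadicCorner (a b : Fin d → ℝ) (k : Fin d → ℕ × Bool) : Fin d → ℝ :=
  fun i => a i + (b i - a i) * dyadicLeft (k i)

/-- The side lengths of the dyadic box with index `k` in `∏ i, [a i, b i]`. -/
noncomputable def dyadicSide (a b : Fin d → ℝ) (k : Fin d → ℕ × Bool) : Fin d → ℝ :=
  fun i => (b i - a i) * dyadicLen (k i)

theorem dyadicSide_pos (hab : ∀ i, a i < b i) (k : Fin d → ℕ × Bool) (i : Fin d) :
    0 < dyadicSide a b k i :=
  mul_pos (sub_pos.2 (hab i)) (dyadicLen_pos _)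

theorem le_dyadicCorner_sub (hab : ∀ i, a i < b i) (k : Fin d → ℕ × Bool) (i : Fin d) :
    a i ≤ dyadicCorner a b k i - dyadicSide a b k i := by
  unfold dyadicCorner dyadicSide
  nlinarith [dyadicLen_le_dyadicLeft (k i), hab i]

theorem dyadicCorner_add_le (hab : ∀ i, a i < b i) (k : Fin d → ℕ × Bool) (i : Fin d) :
    dyadicCorner a b k i + 2 * dyadicSide a b k i ≤ b i := by
  unfold dyadicCorner dyadicSide
  nlinarith [dyadicLeft_add_le (k i), hab i]

theorem prod_dyadicSide (k : Fin d → ℕ × Bool) :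
    ∏ i, dyadicSide a b k i = (∏ i, (b i - a i)) * dyadicVol k := by
  unfold dyadicSide dyadicVol
  exact Finset.prod_mul_distrib

theorem pi_Ioo_subset_iUnion_dyadic (hab : ∀ i, a i < b i) :
    (Set.univ.pi fun i => Set.Ioo (a i) (b i))
      ⊆ ⋃ k, Set.Icc (dyadicCorner a b k) (dyadicCorner a b k + dyadicSide a b k) := by
  intro x hx
  have hw : ∀ i, 0 < b i - a i := fun i => sub_pos.2 (hab i)
  have hx' : ∀ i, ∃ j : ℕ × Bool, dyadicLeft j ≤ (x i - a i) / (b i - a i) ∧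
      (x i - a i) / (b i - a i) ≤ dyadicLeft j + dyadicLen j := fun i =>
    exists_dyadic_mem (div_pos (by linarith [(hx i trivial).1]) (hw i))
      ((div_lt_one (hw i)).2 (by linarith [(hx i trivial).2]))
  choose k hk1 hk2 using hx'
  refine Set.mem_iUnion.2 ⟨k, fun i => ?_, fun i => ?_⟩
  · have := (le_div_iff₀ (hw i)).1 (hk1 i)
    simp only [dyadicCorner]; linarith
  · have := (div_le_iff₀ (hw i)).1 (hk2 i)
    simp only [dyadicCorner, dyadicSide, Pi.add_apply]; linarith

/-- The dyadic boxes cover the open box, whose boundary is null; their overlaps do no harm to an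
upper bound. -/
theorem eLpNorm_sub_le_of_dyadic (hab : ∀ i, a i < b i) {q : ℝ≥0∞} (hq0 : q ≠ 0) (hqt : q ≠ ∞)
    {f g : (Fin d → ℝ) → ℝ} {ρ : (Fin d → ℕ × Bool) → ℝ} (hρ : ∀ k, 0 ≤ ρ k)
    (hfg : ∀ k, ∀ x ∈ Set.Icc (dyadicCorner a b k) (dyadicCorner a b k + dyadicSide a b k),
      |f x - g x| ≤ ρ k)
    (hs : Summable fun k => ρ k ^ q.toReal * ((∏ i, (b i - a i)) * dyadicVol k)) {ε : ℝ}
    (hε : 0 ≤ ε)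
    (hle : ∑' k, ρ k ^ q.toReal * ((∏ i, (b i - a i)) * dyadicVol k) ≤ ε ^ q.toReal) :
    eLpNorm (fun x => f x - g x) q (volume.restrict (Set.Icc a b)) ≤ ENNReal.ofReal ε := by
  have hq' : 0 < q.toReal := ENNReal.toReal_pos hq0 hqt
  have hV : 0 < ∏ i, (b i - a i) := Finset.prod_pos fun i _ => sub_pos.2 (hab i)
  rw [eLpNorm_eq_lintegral_rpow_enorm_toReal hq0 hqt, one_div, ENNReal.rpow_inv_le_iff hq',
    ENNReal.ofReal_rpow_of_nonneg hε hq'.le]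
  refine le_trans ?_ (ENNReal.ofReal_le_ofReal hle)
  rw [ENNReal.ofReal_tsum_of_nonneg (fun k => mul_nonneg (Real.rpow_nonneg (hρ k) _)
    (mul_pos hV (dyadicVol_pos k)).le) hs]
  have hae : (Set.univ.pi fun i => Set.Ioo (a i) (b i)) =ᵐ[volume] Set.Icc a b :=
    Measure.univ_pi_Ioo_ae_eq_Icc
  rw [← Measure.restrict_congr_set hae]
  refine (lintegral_mono_set (pi_Ioo_subset_iUnion_dyadic hab)).trans ?_
  refine (lintegral_iUnion_le _ _).trans (ENNReal.tsum_le_tsum fun k => ?_)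
  calc _ ≤ ∫⁻ _ in Set.Icc (dyadicCorner a b k) (dyadicCorner a b k + dyadicSide a b k),
          ENNReal.ofReal (ρ k ^ q.toReal) := by
        refine setLIntegral_mono' measurableSet_Icc fun x hx => ?_
        rw [Real.enorm_eq_ofReal_abs, ENNReal.ofReal_rpow_of_nonneg (abs_nonneg _) hq'.le]
        exact ENNReal.ofReal_le_ofReal (Real.rpow_le_rpow (abs_nonneg _) (hfg k x hx) hq'.le)
    _ = ENNReal.ofReal (ρ k ^ q.toReal) * ENNReal.ofReal ((∏ i, (b i - a i)) * dyadicVol k) := by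
        rw [setLIntegral_const, Real.volume_Icc_pi, ← prod_dyadicSide,
          ENNReal.ofReal_prod_of_nonneg fun i _ => (dyadicSide_pos hab k i).le]
        simp
    _ ≤ _ := (ENNReal.ofReal_mul (Real.rpow_nonneg (hρ k) _)).ge

end Box

/-! ### The upper bound -/

theorem entropyScale_eq {d : ℕ} (p q : ℝ≥0∞) {a b : Fin d → ℝ} (hab : ∀ i, a i < b i) (B : ℝ) :
    entropyScale p q a b B = B * (∏ i, (b i - a i)) ^ ((q⁻¹).toReal - (p⁻¹).toReal) := by
  unfold entropyScale
  rw [Real.finsetProd_rpow _ _ fun i _ => (sub_pos.2 (hab i)).le]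

theorem toReal_inv_lt_toReal_inv {p q : ℝ≥0∞} (hq : 1 ≤ q) (hqp : q < p) :
    (p⁻¹).toReal < (q⁻¹).toReal :=
  (ENNReal.toReal_lt_toReal (ENNReal.inv_ne_top.2 (hq.trans_lt' one_pos |>.trans hqp).ne')
    (ENNReal.inv_ne_top.2 (hq.trans_lt' one_pos).ne')).2 (ENNReal.inv_lt_inv.2 hqp)

theorem convexEntropy_le_of_codableBy {d : ℕ} {p q : ℝ≥0∞} [Fact (1 ≤ q)] {a b : Fin d → ℝ}
    {B ε y : ℝ} (h : CodableBy (convexClass p a b B) (fun f g =>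
      eLpNorm (fun x => f x - g x) q (volume.restrict (Set.Icc a b)) ≤ ENNReal.ofReal ε)
      (Real.exp y)) :
    convexEntropy p q a b B ε ≤ (y : EReal) := by
  have h' : CodableBy {f : LqFun q (volume.restrict (Set.Icc a b)) | f.1 ∈ convexClass p a b B}
      (fun f g => edist f g ≤ ε.toNNReal) (Real.exp y) := by
    obtain ⟨β, T, Φ, h1, h2, h3⟩ := h
    exact ⟨β, T, fun f => Φ f.1, fun f hf => h1 _ hf, h2, fun f hf g hg hfg => h3 _ hf _ hg hfg⟩
  refine (ENNReal.log_monotone h'.externalCoveringNumber_le).trans (le_of_eq ?_)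
  rw [ENNReal.log_ofReal_of_pos (Real.exp_pos y), Real.log_exp]

theorem exists_convexEntropy_le (d : ℕ) (hd : 1 ≤ d) (p q : ℝ≥0∞) [Fact (1 ≤ q)] (hqp : q < p) :
    ∃ c : ℝ, 0 < c ∧ ∀ (a b : Fin d → ℝ) (B : ℝ), (∀ i, a i < b i) → 0 < B → ∀ ε : ℝ, 0 < ε →
      convexEntropy p q a b B ε
        ≤ ((c * (ε / entropyScale p q a b B) ^ (-(d : ℝ) / 2) : ℝ) : EReal) := by
  have hq1 : 1 ≤ q := Fact.out
  have hq0 : q ≠ 0 := (one_pos.trans_le hq1).ne'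
  have hp0 : p ≠ 0 := (bot_le.trans_lt hqp).ne'
  have hqt : q ≠ ∞ := (hqp.trans_le le_top).ne
  have hPQ := toReal_inv_lt_toReal_inv hq1 hqp
  have hqr : 0 < q.toReal := ENNReal.toReal_pos hq0 hqt
  have hQ : (q⁻¹).toReal * q.toReal = 1 := by
    rw [ENNReal.toReal_inv, inv_mul_cancel₀ hqr.ne']
  have hP0 : 0 ≤ (p⁻¹).toReal := ENNReal.toReal_nonneg
  have : Nonempty (Fin d) := ⟨⟨0, hd⟩⟩
  obtain ⟨C, hC0, hC⟩ := exists_codableBy_unitConvex (ι := Fin d)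
  rw [Fintype.card_fin] at hC
  set P := (p⁻¹).toReal with hP
  set Q := (q⁻¹).toReal with hQdef
  -- Tolerances are proportional to `dyadicVol k ^ (-s)`. From `s < 1/q` the error exponent `t₁` is
  -- positive, and from `s > 1/p` the entropy exponent `t₂` is.
  set s := (P + Q) / 2 with hs
  set t₁ := 1 - s * q.toReal with ht₁
  have ht₁pos : 0 < t₁ := by
    have : s * q.toReal < Q * q.toReal := by gcongr; linarith
    linarith
  set t₂ := (s - P) * (d / 2) with ht₂
  have hd0 : (0 : ℝ) < d := by exact_mod_cast hd
  have ht₂pos : 0 < t₂ := mul_pos (by linarith) (by positivity)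
  have hS₁ := summable_dyadicVol_rpow d ht₁pos
  have hS₂ := summable_dyadicVol_rpow d ht₂pos
  set Z₁ := ∑' k : Fin d → ℕ × Bool, dyadicVol k ^ t₁ with hZ₁
  set Z₂ := ∑' k : Fin d → ℕ × Bool, dyadicVol k ^ t₂ with hZ₂
  have hZ₁0 : 0 ≤ Z₁ := tsum_nonneg fun k => (Real.rpow_pos_of_pos (dyadicVol_pos k) _).le
  have hZ₂0 : 0 ≤ Z₂ := tsum_nonneg fun k => (Real.rpow_pos_of_pos (dyadicVol_pos k) _).le
  -- Normalises the total `L_q` error to at most `ε`.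
  set κ := (Z₁ + 1) ^ (-Q) with hκ
  have hκ0 : 0 < κ := by positivity
  set c₀ := κ / (3 * (4 * 2 ^ d) ^ P) with hc₀
  have hc₀pos : 0 < c₀ := by positivity
  refine ⟨C * c₀ ^ (-(d : ℝ) / 2) * (Z₂ + 1), by positivity, fun a b B hab hB ε hε => ?_⟩
  rw [entropyScale_eq p q hab, ← hP, ← hQdef]
  set V := ∏ i, (b i - a i) with hV
  have hVpos : 0 < V := Finset.prod_pos fun i _ => sub_pos.2 (hab i)
  set S := B * V ^ (Q - P) with hSdef
  have hSpos : 0 < S := by positivity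
  set ρ : (Fin d → ℕ × Bool) → ℝ := fun k => κ * ε * V ^ (-Q) * dyadicVol k ^ (-s)
  have hρ_apply : ∀ k, ρ k = κ * ε * V ^ (-Q) * dyadicVol k ^ (-s) := fun k => rfl
  have hv : ∀ k : Fin d → ℕ × Bool, 0 < dyadicVol k := dyadicVol_pos
  have hρpos : ∀ k, 0 < ρ k := fun k => by
    have := hv k
    positivity
  have hcode := fun k => codableBy_convexClass_box hC hp0 hB (dyadicSide_pos hab k)
    (le_dyadicCorner_sub hab k) (dyadicCorner_add_le hab k) (hρpos k)
  have hexp : ∀ k, C * (ρ k / (3 * (B * (4 / ∏ i, (dyadicSide a b k i / 2)) ^ (p⁻¹).toReal)))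
      ^ (-(d : ℝ) / 2)
      = C * c₀ ^ (-(d : ℝ) / 2) * (ε / S) ^ (-(d : ℝ) / 2) * dyadicVol k ^ t₂ := fun k => by
    have hvk := hv k
    rw [Finset.prod_div_distrib, prod_dyadicSide, ← hV, ← hP]
    simp only [Finset.prod_const, Finset.card_univ, Fintype.card_fin]
    have e1 : (4 / (V * dyadicVol k / 2 ^ d)) ^ P
        = (4 * 2 ^ d) ^ P * V ^ (-P) * dyadicVol k ^ (-P) := by
      rw [show 4 / (V * dyadicVol k / 2 ^ d) = 4 * 2 ^ d / (V * dyadicVol k) by field_simp,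
        Real.div_rpow (by positivity) (by positivity), Real.mul_rpow hVpos.le hvk.le,
        Real.rpow_neg hVpos.le, Real.rpow_neg hvk.le]
      field_simp
    have e2 : ρ k / (3 * (B * (4 / (V * dyadicVol k / 2 ^ d)) ^ P))
        = c₀ * (ε / S) * dyadicVol k ^ (P - s) := by
      rw [e1, hρ_apply, hc₀, hSdef, Real.rpow_sub hVpos, Real.rpow_sub hvk, Real.rpow_neg hVpos.le,
        Real.rpow_neg hVpos.le, Real.rpow_neg hvk.le, Real.rpow_neg hvk.le]
      field_simp
    rw [e2, Real.mul_rpow (by positivity) (by positivity), Real.mul_rpow (by positivity)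
      (by positivity), ← Real.rpow_mul hvk.le, ht₂,
      show (P - s) * (-(d : ℝ) / 2) = (s - P) * (d / 2) by ring]
    ring
  simp only [hexp] at hcode
  have hcode' := CodableBy.forall_tsum (hS₂.mul_left _) (fun k => by
    have := hv k
    positivity) hcode
  rw [tsum_mul_left, ← hZ₂] at hcode'
  have hρq : ∀ k, ρ k ^ q.toReal * (V * dyadicVol k)
      = (Z₁ + 1)⁻¹ * ε ^ q.toReal * dyadicVol k ^ t₁ := fun k => by
    have hvk := hv k
    have e3 : κ ^ q.toReal = (Z₁ + 1)⁻¹ := by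
      rw [hκ, ← Real.rpow_mul (by positivity), neg_mul, hQ, Real.rpow_neg_one]
    have e4 : (V ^ (-Q)) ^ q.toReal = V⁻¹ := by
      rw [← Real.rpow_mul (by positivity), neg_mul, hQ, Real.rpow_neg_one]
    rw [hρ_apply, Real.mul_rpow (by positivity) (by positivity), Real.mul_rpow (by positivity)
      (by positivity), Real.mul_rpow (by positivity) (by positivity), e3, e4,
      ← Real.rpow_mul hvk.le, ht₁, sub_eq_add_neg, Real.rpow_add hvk, Real.rpow_one, neg_mul]
    field_simp
  obtain ⟨β, T, Φ, h1, h2, h3⟩ := hcode'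
  refine convexEntropy_le_of_codableBy ⟨β, T, Φ, h1, h2.trans (Real.exp_le_exp.2 ?_),
    fun f hf g hg hfg => ?_⟩
  · rw [mul_right_comm (C * c₀ ^ (-(d : ℝ) / 2))]
    gcongr
    linarith
  · refine eLpNorm_sub_le_of_dyadic hab hq0 hqt (fun k => (hρpos k).le) (h3 f hf g hg hfg) ?_ hε.le
      ?_
    · simp only [← hV, hρq]
      exact hS₁.mul_left _
    · simp only [← hV, hρq]
      rw [tsum_mul_left, ← hZ₁]
      have : (Z₁ + 1)⁻¹ * Z₁ ≤ 1 := by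
        rw [inv_mul_le_iff₀ (by positivity)]; linarith
      have h0 : 0 ≤ ε ^ q.toReal := by positivity
      nlinarith

/-! ### The lower bound -/

/-! ### Packing in the Hamming cube -/

section Packing

/-- Chernoff: weights `(1/2) ^ |ζ|` sum to `(3/2) ^ N`, and each counted `ζ` weighs at least `2 ^
(-N/8)`. -/
theorem card_filter_card_le {J : Type*} [Fintype J] [DecidableEq J] :
    (((Finset.univ : Finset (Finset J)).filter fun ζ => 8 * ζ.card ≤ Fintype.card J).card : ℝ)
      ≤ Real.exp (Fintype.card J * (Real.log 2 / 8 + Real.log (3 / 2))) := by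
  set N := Fintype.card J with hN
  have h1 : ∑ ζ : Finset J, (1 / 2 : ℝ) ^ ζ.card = (3 / 2) ^ N := by
    have := Finset.sum_pow_mul_eq_add_pow (1 / 2 : ℝ) 1 (Finset.univ : Finset J)
    simp only [one_pow, mul_one, Finset.powerset_univ, Finset.card_univ] at this
    rw [this, hN]; norm_num
  have hpow : ∀ ζ : Finset J, 8 * ζ.card ≤ N →
      Real.exp (-(N * (Real.log 2 / 8))) ≤ (1 / 2 : ℝ) ^ ζ.card := fun ζ hζ => by
    have h8 : 8 * (ζ.card : ℝ) ≤ N := by exact_mod_cast hζ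
    rw [one_div, inv_pow, ← Real.exp_log (by positivity : (0 : ℝ) < (2 ^ ζ.card)⁻¹),
      Real.log_inv, Real.log_pow, Real.exp_le_exp]
    nlinarith [Real.log_pos (by norm_num : (1 : ℝ) < 2)]
  have h2 : (((Finset.univ : Finset (Finset J)).filter fun ζ => 8 * ζ.card ≤ N).card : ℝ)
      * Real.exp (-(N * (Real.log 2 / 8))) ≤ (3 / 2) ^ N := by
    rw [← h1, ← nsmul_eq_mul]
    refine (Finset.card_nsmul_le_sum _ _ _ fun ζ hζ => hpow ζ (Finset.mem_filter.1 hζ).2).trans ?_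
    exact Finset.sum_le_sum_of_subset_of_nonneg (Finset.filter_subset _ _) fun _ _ _ => by
      positivity
  rw [mul_add, Real.exp_add, mul_comm (N : ℝ) (Real.log (3 / 2)), ← Real.rpow_def_of_pos
    (by norm_num), Real.rpow_natCast]
  rw [Real.exp_neg, ← div_eq_mul_inv, div_le_iff₀ (Real.exp_pos _)] at h2
  linarith

/-- The exponent `log (4/3) - log 2 / 8` in the packing bound. -/
noncomputable def packingRate : ℝ := Real.log (4 / 3) - Real.log 2 / 8

/-- Amounts to `2 < (4/3) ^ 8`: a Hamming ball of radius `N / 8` is an exponentially small part of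
the cube. -/
theorem packingRate_pos : 0 < packingRate := by
  have h : Real.log 2 < Real.log ((4 / 3) ^ 8) := Real.log_lt_log (by norm_num) (by norm_num)
  rw [Real.log_pow] at h
  push_cast at h
  unfold packingRate
  linarith

/-- If points indexed by the subsets of `J` are `2ε`-close only for subsets whose Hamming distance
is at most `|J| / 8`, then covering them takes exponentially many balls of radius `ε`. -/
theorem exp_le_externalCoveringNumber {X J : Type*} [PseudoEMetricSpace X] [Fintype J]
    [DecidableEq J] {A : Set X} {ε : NNReal} (F : Finset J → X) (hF : ∀ η, F η ∈ A)
    (hsep : ∀ η η' : Finset J, edist (F η) (F η') ≤ 2 * ε →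
      8 * (symmDiff η η').card ≤ Fintype.card J) :
    ENNReal.ofReal (Real.exp (packingRate * Fintype.card J))
      ≤ ((Metric.externalCoveringNumber ε A : ℕ∞) : ℝ≥0∞) := by
  classical
  obtain ⟨C, hC, hCcard⟩ : ∃ C : Set X, Metric.IsCover ε A C ∧
      C.encard = Metric.externalCoveringNumber ε A := by
    have : Nonempty {C : Set X // Metric.IsCover ε A C} := ⟨A, Metric.IsCover.refl ε A⟩
    obtain ⟨C, hC⟩ := ENat.exists_eq_iInf
      fun C : {C : Set X // Metric.IsCover ε A C} => C.1.encard
    exact ⟨C.1, C.2, by rw [hC, iInf_subtype]; rfl⟩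
  rw [← hCcard]
  rcases C.finite_or_infinite with hfin | hinf
  · choose R hRC hR using fun η => hC (hF η)
    replace hR : ∀ η, edist (F η) (R η) ≤ ε := hR
    set N := Fintype.card J with hN
    set K := ((Finset.univ : Finset (Finset J)).filter fun ζ => 8 * ζ.card ≤ N).card with hK
    -- Subsets served by one centre are `2ε`-close, so `symmDiff η₀` injects the fibre into the
    -- small sets.
    have hfib : ∀ c ∈ (Finset.univ : Finset (Finset J)).image R,
        ((Finset.univ : Finset (Finset J)).filter fun η => R η = c).card ≤ K := fun c hc => by
      obtain ⟨η₀, -, hη₀⟩ := Finset.mem_image.1 hc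
      refine Finset.card_le_card_of_injOn (fun η => symmDiff η₀ η) (fun η hη => ?_)
        ((symmDiff_right_injective η₀).injOn)
      have hη' : R η = c := (Finset.mem_filter.1 hη).2
      refine Finset.mem_filter.2 ⟨Finset.mem_univ _, hsep η₀ η ?_⟩
      calc edist (F η₀) (F η) ≤ edist (F η₀) c + edist (F η) c := edist_triangle_right _ _ _
        _ ≤ ε + ε := add_le_add (hη₀ ▸ hR η₀) (hη' ▸ hR η)
        _ = 2 * ε := (two_mul _).symm
    have hcount := Finset.card_le_mul_card_image _ K hfib
    have hle : ((Finset.univ : Finset (Finset J)).image R).card ≤ hfin.toFinset.card :=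
      Finset.card_le_card fun c hc => by
        obtain ⟨η, -, rfl⟩ := Finset.mem_image.1 hc
        exact hfin.mem_toFinset.2 (hRC η)
    rw [Finset.card_univ, Fintype.card_finset] at hcount
    have hreal : (2 : ℝ) ^ N ≤ K * hfin.toFinset.card := by
      exact_mod_cast hcount.trans (Nat.mul_le_mul_left _ hle)
    have hKle : (K : ℝ) ≤ Real.exp (N * (Real.log 2 / 8 + Real.log (3 / 2))) := card_filter_card_le
    have hmain : Real.exp (packingRate * N) ≤ hfin.toFinset.card := by
      have h2 : (2 : ℝ) ^ N = Real.exp (packingRate * N)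
          * Real.exp (N * (Real.log 2 / 8 + Real.log (3 / 2))) := by
        rw [← Real.exp_add, ← Real.rpow_natCast, Real.rpow_def_of_pos (by norm_num)]
        congr 1
        have : Real.log (4 / 3) + Real.log (3 / 2) = Real.log 2 := by
          rw [← Real.log_mul (by norm_num) (by norm_num)]; norm_num
        unfold packingRate
        linear_combination -(N : ℝ) * this
      have h3 : Real.exp (packingRate * N) * Real.exp (N * (Real.log 2 / 8 + Real.log (3 / 2)))
          ≤ hfin.toFinset.card * Real.exp (N * (Real.log 2 / 8 + Real.log (3 / 2))) := by
        rw [← h2]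
        refine hreal.trans ?_
        rw [mul_comm]
        gcongr
      exact le_of_mul_le_mul_right h3 (Real.exp_pos _)
    rw [hfin.encard_eq_coe_toFinset_card]
    calc _ ≤ ENNReal.ofReal (hfin.toFinset.card : ℝ) := ENNReal.ofReal_le_ofReal hmain
      _ = _ := by simp
  · rw [hinf.encard_eq]; simp

end Packing

/-! ### Paraboloids with raised tangent planes -/

section Bumps

variable {ι J : Type*} [Fintype ι]

/-- The paraboloid `|t|²` (for `none`) and its tangent planes at the points `c j`, raised by
`δ²`. -/
def bumpPiece (c : J → ι → ℝ) (δ : ℝ) : Option J → (ι → ℝ) → ℝ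
  | none, t => ∑ i, t i ^ 2
  | some j, t => ∑ i, (2 * c j i * t i - c j i ^ 2) + δ ^ 2

/-- The paraboloid `|t|²` with the raised tangent planes at the points `c j`, `j ∈ η`, cut in. -/
noncomputable def bumpFun (c : J → ι → ℝ) (δ : ℝ) (η : Finset J) (t : ι → ℝ) : ℝ :=
  (Finset.insertNone η).sup' ⟨none, by simp⟩ fun o => bumpPiece c δ o t

variable {c : J → ι → ℝ} {δ : ℝ} {η : Finset J} {t : ι → ℝ}

/-- Shows that a raised plane lies above the paraboloid only within distance `δ` of its point of
tangency. -/
theorem bumpPiece_some (j : J) :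
    bumpPiece c δ (some j) t = ∑ i, t i ^ 2 + δ ^ 2 - ∑ i, (t i - c j i) ^ 2 := by
  have : ∑ i, t i ^ 2 = ∑ i, (2 * c j i * t i - c j i ^ 2) + ∑ i, (t i - c j i) ^ 2 := by
    rw [← Finset.sum_add_distrib]
    exact Finset.sum_congr rfl fun i _ => by ring
  simp only [bumpPiece]
  linarith

theorem sum_sq_le_bumpFun : ∑ i, t i ^ 2 ≤ bumpFun c δ η t :=
  Finset.le_sup' (fun o => bumpPiece c δ o t) (b := none) (by simp)

theorem le_bumpFun_of_mem {j : J} (hj : j ∈ η) :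
    ∑ i, t i ^ 2 + δ ^ 2 - ∑ i, (t i - c j i) ^ 2 ≤ bumpFun c δ η t := by
  rw [← bumpPiece_some]
  exact Finset.le_sup' (fun o => bumpPiece c δ o t) (by simpa using hj)

theorem bumpFun_le_of_far (h : ∀ j ∈ η, δ ^ 2 ≤ ∑ i, (t i - c j i) ^ 2) :
    bumpFun c δ η t ≤ ∑ i, t i ^ 2 := by
  refine Finset.sup'_le _ _ fun o ho => ?_
  cases o with
  | none => exact le_rfl
  | some j =>
    rw [bumpPiece_some]
    linarith [h j (by simpa using ho)]

theorem bumpFun_le : bumpFun c δ η t ≤ ∑ i, t i ^ 2 + δ ^ 2 := by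
  refine Finset.sup'_le _ _ fun o _ => ?_
  cases o with
  | none => exact le_add_of_nonneg_right (sq_nonneg δ)
  | some j =>
    rw [bumpPiece_some]
    have : 0 ≤ ∑ i, (t i - c j i) ^ 2 := Finset.sum_nonneg fun i _ => sq_nonneg _
    linarith

theorem bumpFun_convex (s t : ι → ℝ) {x y : ℝ} (hx : 0 ≤ x) (hy : 0 ≤ y) (hxy : x + y = 1) :
    bumpFun c δ η (x • s + y • t) ≤ x * bumpFun c δ η s + y * bumpFun c δ η t := by
  refine Finset.sup'_le _ _ fun o ho => ?_
  have hs : bumpPiece c δ o s ≤ bumpFun c δ η s :=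
    Finset.le_sup' (fun o => bumpPiece c δ o s) ho
  have ht : bumpPiece c δ o t ≤ bumpFun c δ η t :=
    Finset.le_sup' (fun o => bumpPiece c δ o t) ho
  refine le_trans ?_ (add_le_add (mul_le_mul_of_nonneg_left hs hx)
    (mul_le_mul_of_nonneg_left ht hy))
  obtain rfl : y = 1 - x := by linarith
  cases o with
  | none =>
    simp only [bumpPiece, Pi.add_apply, Pi.smul_apply, smul_eq_mul, Finset.mul_sum]
    rw [← Finset.sum_add_distrib]
    exact Finset.sum_le_sum fun i _ => by
      nlinarith [mul_nonneg (mul_nonneg hx hy) (sq_nonneg (s i - t i))]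
  | some j =>
    refine le_of_eq ?_
    simp only [bumpPiece, Pi.add_apply, Pi.smul_apply, smul_eq_mul]
    have : ∑ i, (2 * c j i * (x * s i + (1 - x) * t i) - c j i ^ 2)
        = x * ∑ i, (2 * c j i * s i - c j i ^ 2)
          + (1 - x) * ∑ i, (2 * c j i * t i - c j i ^ 2) := by
      rw [Finset.mul_sum, Finset.mul_sum, ← Finset.sum_add_distrib]
      exact Finset.sum_congr rfl fun i _ => by ring
    rw [this]; ring

/-- Within `δ / 2` of `c j` plane `j` lifts the paraboloid by at least `3/4 δ²`, and no other plane
lifts it at all. -/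
theorem le_abs_bumpFun_sub [DecidableEq J] {η' : Finset J} {j : J} (hj : j ∈ symmDiff η η')
    (hnear : ∑ i, (t i - c j i) ^ 2 ≤ δ ^ 2 / 4)
    (hfar : ∀ j', j' ≠ j → δ ^ 2 ≤ ∑ i, (t i - c j' i) ^ 2) :
    3 / 4 * δ ^ 2 ≤ |bumpFun c δ η t - bumpFun c δ η' t| := by
  have key : ∀ ξ ξ' : Finset J, j ∈ ξ → j ∉ ξ' →
      3 / 4 * δ ^ 2 ≤ bumpFun c δ ξ t - bumpFun c δ ξ' t := fun ξ ξ' h h' => by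
    have h1 := le_bumpFun_of_mem (c := c) (δ := δ) (t := t) h
    have h2 := bumpFun_le_of_far (c := c) (δ := δ) (t := t) (η := ξ') fun j' hj' =>
      hfar j' fun e => h' (e ▸ hj')
    linarith
  rcases Finset.mem_symmDiff.1 hj with ⟨h, h'⟩ | ⟨h, h'⟩
  · exact (key _ _ h h').trans (le_abs_self _)
  · rw [abs_sub_comm]
    exact (key _ _ h h').trans (le_abs_self _)

end Bumps

theorem le_eLpNorm_rpow_of_disjoint {Ω J : Type*} [MeasurableSpace Ω] {μ : Measure Ω} {I : Set Ω}
    {q : ℝ≥0∞} (hq0 : q ≠ 0) (hqt : q ≠ ∞) {f : Ω → ℝ} (D : Finset J) {s : J → Set Ω}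
    (hs : ∀ j, MeasurableSet (s j)) (hsI : ∀ j, s j ⊆ I)
    (hdisj : Pairwise fun j j' => Disjoint (s j) (s j')) {v m : ℝ} (hm : 0 ≤ m)
    (hv : ∀ j, μ (s j) = ENNReal.ofReal v) (hf : ∀ j ∈ D, ∀ x ∈ s j, m ≤ |f x|) :
    ENNReal.ofReal (D.card * (m ^ q.toReal * v)) ≤ eLpNorm f q (μ.restrict I) ^ q.toReal := by
  have hq' : 0 < q.toReal := ENNReal.toReal_pos hq0 hqt
  rw [eLpNorm_eq_lintegral_rpow_enorm_toReal hq0 hqt, one_div, ENNReal.rpow_inv_rpow hq'.ne']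
  have hsub : (⋃ j ∈ D, s j) ⊆ I := Set.iUnion₂_subset fun j _ => hsI j
  refine le_trans ?_ (lintegral_mono_set hsub)
  rw [lintegral_biUnion_finset (fun j _ j' _ h => hdisj h) fun j _ => hs j]
  calc ENNReal.ofReal (D.card * (m ^ q.toReal * v))
      = ∑ j ∈ D, ENNReal.ofReal (m ^ q.toReal) * μ (s j) := by
        simp only [hv, Finset.sum_const, nsmul_eq_mul]
        rw [ENNReal.ofReal_mul (by positivity), ENNReal.ofReal_mul (by positivity),
          ENNReal.ofReal_natCast]
    _ ≤ _ := Finset.sum_le_sum fun j hj => by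
        rw [← setLIntegral_const]
        refine setLIntegral_mono' (hs j) fun x hx => ?_
        rw [Real.enorm_eq_ofReal_abs, ENNReal.ofReal_rpow_of_nonneg (abs_nonneg _) hq'.le]
        exact ENNReal.ofReal_le_ofReal (Real.rpow_le_rpow hm (hf j hj x hx) hq'.le)

/-! ### Cells of the unit cube -/

section Cells

variable {d n : ℕ}

/-- The centre of the cell with index `j` in the partition of the unit cube into `n ^ d` cells. -/
noncomputable def cellCenter (j : Fin d → Fin n) (i : Fin d) : ℝ :=
  (2 * ((j i : ℕ) : ℝ) + 1) / (2 * n)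

theorem le_cellCenter (j : Fin d → Fin n) (i : Fin d) : 1 / (2 * n) ≤ cellCenter j i := by
  unfold cellCenter
  gcongr
  linarith [(Nat.cast_nonneg (j i : ℕ) : (0 : ℝ) ≤ _)]

theorem cellCenter_le (hn : 1 ≤ n) (j : Fin d → Fin n) (i : Fin d) :
    cellCenter j i ≤ 1 - 1 / (2 * n) := by
  have hn' : (0 : ℝ) < n := by exact_mod_cast hn
  have hj : ((j i : ℕ) : ℝ) + 1 ≤ n := by exact_mod_cast (j i).2
  unfold cellCenter
  rw [le_sub_iff_add_le, ← add_div, div_le_one (by positivity)]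
  linarith

theorem exists_le_abs_cellCenter_sub (hn : 1 ≤ n) {j j' : Fin d → Fin n} (h : j' ≠ j) :
    ∃ i, 2 * (1 / (2 * n)) ≤ |cellCenter j i - cellCenter j' i| := by
  have hn' : (0 : ℝ) < n := by exact_mod_cast hn
  obtain ⟨i, hi⟩ := Function.ne_iff.1 h
  refine ⟨i, ?_⟩
  have hne : ((j i : ℕ) : ℤ) - (j' i : ℕ) ≠ 0 := fun e => hi (Fin.ext (by omega))
  have h1 : (1 : ℝ) ≤ |((j i : ℕ) : ℝ) - (j' i : ℕ)| := by exact_mod_cast Int.one_le_abs hne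
  have e : cellCenter j i - cellCenter j' i
      = 2 * (1 / (2 * n)) * (((j i : ℕ) : ℝ) - (j' i : ℕ)) := by
    unfold cellCenter; ring
  rw [e, abs_mul, abs_of_pos (by positivity)]
  exact le_mul_of_one_le_right (by positivity) h1

variable {t : Fin d → ℝ} {j : Fin d → Fin n}

/-- Half-width `δ / (2d)`, with `δ = 1 / (2n)`, puts the subcube inside the ball of radius `δ / 2`,
as `√d ≤ d`. -/
theorem sum_sq_sub_cellCenter_le (hd : 1 ≤ d)
    (ht : ∀ i, |t i - cellCenter j i| ≤ 1 / (2 * n) / (2 * d)) :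
    ∑ i, (t i - cellCenter j i) ^ 2 ≤ (1 / (2 * n) : ℝ) ^ 2 / 4 := by
  have hd' : (1 : ℝ) ≤ d := by exact_mod_cast hd
  calc ∑ i, (t i - cellCenter j i) ^ 2 ≤ ∑ _i : Fin d, (1 / (2 * n) / (2 * d) : ℝ) ^ 2 :=
        Finset.sum_le_sum fun i _ => sq_le_sq' (abs_le.1 (ht i)).1 (abs_le.1 (ht i)).2
    _ = (1 / (2 * n) : ℝ) ^ 2 / 4 * (1 / d) := by
        rw [Finset.sum_const, Finset.card_univ, Fintype.card_fin, nsmul_eq_mul]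
        field_simp; norm_num
    _ ≤ _ := mul_le_of_le_one_right (by positivity) ((div_le_one (by positivity)).2 hd')

/-- Distinct centres are `2δ` apart in some coordinate, and `t` is within `δ` of its own. -/
theorem le_sum_sq_sub_cellCenter (hd : 1 ≤ d) (hn : 1 ≤ n)
    (ht : ∀ i, |t i - cellCenter j i| ≤ 1 / (2 * n) / (2 * d)) {j' : Fin d → Fin n} (h : j' ≠ j) :
    (1 / (2 * n) : ℝ) ^ 2 ≤ ∑ i, (t i - cellCenter j' i) ^ 2 := by
  have hd' : (1 : ℝ) ≤ d := by exact_mod_cast hd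
  have hδ : (0 : ℝ) ≤ 1 / (2 * n) := by positivity
  obtain ⟨i, hi⟩ := exists_le_abs_cellCenter_sub hn h
  refine le_trans ?_ (Finset.single_le_sum (fun i _ => sq_nonneg (t i - cellCenter j' i))
    (Finset.mem_univ i))
  rw [sq_le_sq, abs_of_nonneg hδ]
  have h1 : 1 / (2 * n) / (2 * d) ≤ (1 / (2 * n) : ℝ) := div_le_self hδ (by linarith)
  have h2 := abs_sub_le (cellCenter j i) (t i) (cellCenter j' i)
  rw [abs_sub_comm (cellCenter j i) (t i)] at h2
  linarith [ht i]

end Cells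

/-! ### Lower bound on a general box -/

section LowerBound

variable {d : ℕ} {p q : ℝ≥0∞} {a b : Fin d → ℝ} {B : ℝ}

theorem mem_convexClass_of_abs_le (hp : p ≠ 0) (hab : ∀ i, a i < b i) (hB : 0 < B)
    {f : (Fin d → ℝ) → ℝ} (hf : ConvexOn ℝ (Set.Icc a b) f)
    (hle : ∀ x ∈ Set.Icc a b, |f x| ≤ B * (∏ i, (b i - a i)) ^ (-(p⁻¹).toReal)) :
    f ∈ convexClass p a b B := by
  have hV : 0 < ∏ i, (b i - a i) := Finset.prod_pos fun i _ => sub_pos.2 (hab i)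
  refine ⟨hf, ?_⟩
  split_ifs with ht
  · subst ht
    simpa using hle
  · have hp' : 0 < p.toReal := ENNReal.toReal_pos hp ht
    calc ∫⁻ x in Set.Icc a b, ENNReal.ofReal |f x| ^ p.toReal
        ≤ ∫⁻ _ in Set.Icc a b,
            ENNReal.ofReal (B * (∏ i, (b i - a i)) ^ (-(p⁻¹).toReal)) ^ p.toReal :=
          setLIntegral_mono' measurableSet_Icc fun x hx =>
            ENNReal.rpow_le_rpow (ENNReal.ofReal_le_ofReal (hle x hx)) hp'.le
      _ = ENNReal.ofReal (B ^ p.toReal) := by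
          rw [setLIntegral_const, Real.volume_Icc_pi,
            ← ENNReal.ofReal_prod_of_nonneg fun i _ => (sub_pos.2 (hab i)).le,
            ENNReal.ofReal_rpow_of_pos (by positivity), ← ENNReal.ofReal_mul (by positivity),
            Real.mul_rpow hB.le (by positivity), ← Real.rpow_mul hV.le, neg_mul,
            ENNReal.toReal_inv, inv_mul_cancel₀ hp'.ne', Real.rpow_neg_one,
            inv_mul_cancel_right₀ hV.ne']
      _ = _ := (ENNReal.ofReal_rpow_of_pos hB).symm

/-- The convex function on the box that looks like `bumpFun` in the coordinates of the unit cube. -/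
noncomputable def boxBump (a b : Fin d → ℝ) (A : ℝ) (n : ℕ) (η : Finset (Fin d → Fin n))
    (x : Fin d → ℝ) : ℝ :=
  A * bumpFun cellCenter (1 / (2 * n)) η fun i => (x i - a i) / (b i - a i)

theorem boxBump_mem_convexClass (hp : p ≠ 0) (hab : ∀ i, a i < b i) (hB : 0 < B) {n : ℕ}
    (hn : 1 ≤ n) (η : Finset (Fin d → Fin n)) :
    boxBump a b (B * (∏ i, (b i - a i)) ^ (-(p⁻¹).toReal) / (d + 1)) n η
      ∈ convexClass p a b B := by
  have hV : 0 < ∏ i, (b i - a i) := Finset.prod_pos fun i _ => sub_pos.2 (hab i)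
  have hn' : (1 : ℝ) ≤ n := by exact_mod_cast hn
  refine mem_convexClass_of_abs_le hp hab hB ⟨convex_Icc a b, fun x _ y _ r s hr hs hrs => ?_⟩
    fun x hx => ?_
  · have hpt : (fun i => ((r • x + s • y) i - a i) / (b i - a i))
        = r • (fun i => (x i - a i) / (b i - a i)) + s • fun i => (y i - a i) / (b i - a i) := by
      funext i
      simp only [Pi.add_apply, Pi.smul_apply, smul_eq_mul]
      rw [← mul_div_assoc, ← mul_div_assoc, ← add_div]
      congr 1
      linear_combination (a i) * hrs
    have hle := bumpFun_convex (c := cellCenter) (δ := 1 / (2 * n)) (η := η)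
      (fun i => (x i - a i) / (b i - a i)) (fun i => (y i - a i) / (b i - a i)) hr hs hrs
    simp only [boxBump, hpt, smul_eq_mul]
    have hA : 0 ≤ B * (∏ i, (b i - a i)) ^ (-(p⁻¹).toReal) / (d + 1) := by positivity
    nlinarith [mul_le_mul_of_nonneg_left hle hA]
  · have h0 : (0 : ℝ) ≤ ∑ i, ((x i - a i) / (b i - a i)) ^ 2 :=
      Finset.sum_nonneg fun i _ => sq_nonneg _
    have h1 : ∑ i, ((x i - a i) / (b i - a i)) ^ 2 ≤ (d : ℝ) := by
      have : ∑ i : Fin d, ((x i - a i) / (b i - a i)) ^ 2 ≤ ∑ _i : Fin d, (1 : ℝ) :=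
        Finset.sum_le_sum fun i _ => by
          have hw := sub_pos.2 (hab i)
          refine pow_le_one₀ (div_nonneg (by linarith [hx.1 i]) hw.le) ?_
          rw [div_le_one hw]; linarith [hx.2 i]
      simpa using this
    have h2 := sum_sq_le_bumpFun (c := cellCenter) (δ := 1 / (2 * n)) (η := η)
      (t := fun i => (x i - a i) / (b i - a i))
    have h3 := bumpFun_le (c := cellCenter) (δ := 1 / (2 * n)) (η := η)
      (t := fun i => (x i - a i) / (b i - a i))
    have h4 : (1 / (2 * n) : ℝ) ^ 2 ≤ 1 :=
      pow_le_one₀ (by positivity) ((div_le_one (by positivity)).2 (by linarith))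
    -- The bump function lies between `0` and `d + δ² ≤ d + 1`, hence the divisor `d + 1` in the
    -- amplitude.
    rw [boxBump, abs_of_nonneg (mul_nonneg (by positivity) (h0.trans h2)), div_mul_eq_mul_div,
      div_le_iff₀ (by positivity)]
    gcongr
    linarith

/-- The bound on `2 * ε` is the `L_q` size of a height `A * (3/4 δ²)` on `n ^ d / 8` subcells. Their
total volume is `V / (8 (2d)^d)`, since `n δ = 1/2`. -/
theorem le_convexEntropy_of_cells (hd : 1 ≤ d) [Fact (1 ≤ q)] (hqp : q < p)
    (hab : ∀ i, a i < b i) (hB : 0 < B) {n : ℕ} (hn : 1 ≤ n) {ε : ℝ} (hε : 0 < ε)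
    (hεn : 2 * ε ≤ B * (∏ i, (b i - a i)) ^ (-(p⁻¹).toReal) / (d + 1)
      * (3 / 4 * (1 / (2 * n)) ^ 2) * (∏ i, (b i - a i)) ^ (q⁻¹).toReal
      * (8 * (2 * d) ^ d) ^ (-(q⁻¹).toReal)) :
    ((packingRate * n ^ d : ℝ) : EReal) ≤ convexEntropy p q a b B ε := by
  have hq1 : 1 ≤ q := Fact.out
  have hq0 : q ≠ 0 := (one_pos.trans_le hq1).ne'
  have hp0 : p ≠ 0 := (bot_le.trans_lt hqp).ne'
  have hqt : q ≠ ∞ := (hqp.trans_le le_top).ne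
  have hqr : 0 < q.toReal := ENNReal.toReal_pos hq0 hqt
  have hQ : (q⁻¹).toReal * q.toReal = 1 := by
    rw [ENNReal.toReal_inv, inv_mul_cancel₀ hqr.ne']
  have hd' : (0 : ℝ) < d := by exact_mod_cast hd
  have hn' : (0 : ℝ) < n := by exact_mod_cast hn
  set V := ∏ i, (b i - a i) with hV
  have hVpos : 0 < V := Finset.prod_pos fun i _ => sub_pos.2 (hab i)
  set A := B * V ^ (-(p⁻¹).toReal) / (d + 1) with hA
  have hApos : 0 < A := by positivity
  set δ : ℝ := 1 / (2 * n) with hδ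
  have hδpos : 0 < δ := by positivity
  set cell : (Fin d → Fin n) → Set (Fin d → ℝ) := fun j =>
    Set.Icc (fun i => a i + (b i - a i) * (cellCenter j i - δ / (2 * d)))
      (fun i => a i + (b i - a i) * (cellCenter j i + δ / (2 * d))) with hcell
  have hnear : ∀ j, ∀ x ∈ cell j, ∀ i,
      |(x i - a i) / (b i - a i) - cellCenter j i| ≤ δ / (2 * d) := fun j x hx i => by
    have hw := sub_pos.2 (hab i)
    have h1 : cellCenter j i - δ / (2 * d) ≤ (x i - a i) / (b i - a i) := by
      rw [le_div_iff₀ hw]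
      have := hx.1 i
      simp only at this
      linarith
    have h2 : (x i - a i) / (b i - a i) ≤ cellCenter j i + δ / (2 * d) := by
      rw [div_le_iff₀ hw]
      have := hx.2 i
      simp only at this
      linarith
    rw [abs_le]; constructor <;> linarith
  have hcellI : ∀ j, cell j ⊆ Set.Icc a b := fun j x hx => by
    have hsmall : δ / (2 * d) ≤ δ := div_le_self hδpos.le (by
      have : (1 : ℝ) ≤ d := by exact_mod_cast hd
      linarith)
    refine ⟨fun i => ?_, fun i => ?_⟩
    · have := hx.1 i
      simp only at this
      nlinarith [hab i, le_cellCenter j i]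
    · have := hx.2 i
      simp only at this
      nlinarith [hab i, cellCenter_le hn j i]
  have hdisj : Pairwise fun j j' => Disjoint (cell j) (cell j') := fun j j' hne => by
    refine Set.disjoint_left.2 fun x hx hx' => ?_
    have h1 := sum_sq_sub_cellCenter_le hd (hnear j x hx)
    have h2 := le_sum_sq_sub_cellCenter hd hn (hnear j' x hx') hne
    have : 0 < δ ^ 2 := by positivity
    linarith
  have hvol : ∀ j, volume (cell j) = ENNReal.ofReal (V * (δ / d) ^ d) := fun j => by
    have : V * (δ / d) ^ d = ∏ i, ((b i - a i) * (δ / d)) := by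
      rw [Finset.prod_mul_distrib, Finset.prod_const, Finset.card_univ, Fintype.card_fin]
    rw [hcell, Real.volume_Icc_pi, this, ENNReal.ofReal_prod_of_nonneg fun i _ =>
      mul_nonneg (sub_pos.2 (hab i)).le (by positivity)]
    refine Finset.prod_congr rfl fun i _ => ?_
    congr 1
    field_simp
    ring
  have hmem := fun η => boxBump_mem_convexClass (p := p) hp0 hab hB hn η
  have hsep : ∀ η η' : Finset (Fin d → Fin n),
      eLpNorm (fun x => boxBump a b A n η x - boxBump a b A n η' x) q
        (volume.restrict (Set.Icc a b)) ≤ ENNReal.ofReal (2 * ε) →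
      8 * (symmDiff η η').card ≤ n ^ d := fun η η' hle => by
    have h1 := le_eLpNorm_rpow_of_disjoint hq0 hqt (μ := volume)
      (f := fun x => boxBump a b A n η x - boxBump a b A n η' x) (symmDiff η η')
      (fun j => measurableSet_Icc) hcellI hdisj (m := A * (3 / 4 * δ ^ 2)) (by positivity) hvol
      fun j hj x hx => by
        rw [boxBump, boxBump, ← mul_sub, abs_mul, abs_of_pos hApos]
        exact mul_le_mul_of_nonneg_left (le_abs_bumpFun_sub hj
          (sum_sq_sub_cellCenter_le hd (hnear j x hx)) fun j' hj' =>
            le_sum_sq_sub_cellCenter hd hn (hnear j x hx) hj') hApos.le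
    have h2 := h1.trans (ENNReal.rpow_le_rpow hle hqr.le)
    rw [ENNReal.ofReal_rpow_of_pos (by positivity), ENNReal.ofReal_le_ofReal_iff (by positivity)]
      at h2
    have h3 : (2 * ε) ^ q.toReal
        ≤ (A * (3 / 4 * δ ^ 2)) ^ q.toReal * V * (8 * (2 * (d : ℝ)) ^ d)⁻¹ := by
      refine (Real.rpow_le_rpow (by positivity) hεn hqr.le).trans (le_of_eq ?_)
      rw [Real.mul_rpow (by positivity) (by positivity), Real.mul_rpow (by positivity)
        (by positivity), ← Real.rpow_mul (by positivity) (q⁻¹).toReal,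
        ← Real.rpow_mul (by positivity) (-(q⁻¹).toReal), neg_mul, hQ, Real.rpow_one,
        Real.rpow_neg_one]
    set m := (A * (3 / 4 * δ ^ 2)) ^ q.toReal with hm
    have hmpos : 0 < m := by positivity
    have h4 : ((symmDiff η η').card : ℝ) * (m * (V * (δ / d) ^ d))
        ≤ (n : ℝ) ^ d / 8 * (m * (V * (δ / d) ^ d)) := by
      refine (h2.trans h3).trans (le_of_eq ?_)
      have : (n : ℝ) ^ d * (δ / d) ^ d = ((2 * (d : ℝ)) ^ d)⁻¹ := by
        rw [← mul_pow, ← inv_pow, hδ]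
        congr 1
        field_simp
      rw [mul_inv, ← this]; ring
    have h5 : ((symmDiff η η').card : ℝ) ≤ (n : ℝ) ^ d / 8 :=
      le_of_mul_le_mul_right h4 (by positivity)
    have h6 : (8 : ℝ) * (symmDiff η η').card ≤ (n : ℝ) ^ d := by linarith
    exact_mod_cast h6
  have hcov := exp_le_externalCoveringNumber (ε := ε.toNNReal)
    (A := {f : LqFun q (volume.restrict (Set.Icc a b)) | f.1 ∈ convexClass p a b B})
    (fun η => ⟨boxBump a b A n η, memLp_of_mem_convexClass hp0 hqp.le (hmem η)⟩) hmem
    fun η η' hle => by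
      rw [Fintype.card_fun, Fintype.card_fin, Fintype.card_fin]
      refine hsep η η' (le_trans hle (le_of_eq ?_))
      rw [ENNReal.ofReal_mul (by norm_num)]
      simp [ENNReal.ofReal]
  have hlog := ENNReal.log_monotone hcov
  rw [ENNReal.log_ofReal_of_pos (Real.exp_pos _), Real.log_exp, Fintype.card_fun, Fintype.card_fin,
    Fintype.card_fin, Nat.cast_pow] at hlog
  exact hlog

theorem exists_le_convexEntropy (d : ℕ) (hd : 1 ≤ d) (p q : ℝ≥0∞) [Fact (1 ≤ q)] (hqp : q < p) :
    ∃ c ε₀ : ℝ, 0 < c ∧ 0 < ε₀ ∧ ∀ (a b : Fin d → ℝ) (B : ℝ), (∀ i, a i < b i) → 0 < B →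
      ∀ ε : ℝ, 0 < ε → ε ≤ ε₀ * entropyScale p q a b B →
        ((c * (ε / entropyScale p q a b B) ^ (-(d : ℝ) / 2) : ℝ) : EReal)
          ≤ convexEntropy p q a b B ε := by
  have hd' : (0 : ℝ) < d := by exact_mod_cast hd
  set κ : ℝ := (8 * (2 * d) ^ d) ^ (-(q⁻¹).toReal) with hκ
  have hκpos : 0 < κ := by positivity
  -- Chosen so that the condition of `le_convexEntropy_of_cells` becomes `ε n² ≤ θ S`.
  set θ : ℝ := 3 * κ / (32 * (d + 1)) with hθ
  have hθpos : 0 < θ := by positivity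
  have hrate := packingRate_pos
  refine ⟨packingRate * ((1 / 2) ^ d * θ ^ ((d : ℝ) / 2)), θ, by positivity, hθpos,
    fun a b B hab hB ε hε hεS => ?_⟩
  rw [entropyScale_eq p q hab] at hεS ⊢
  set V := ∏ i, (b i - a i) with hV
  have hVpos : 0 < V := Finset.prod_pos fun i _ => sub_pos.2 (hab i)
  set S := B * V ^ ((q⁻¹).toReal - (p⁻¹).toReal) with hS
  have hSpos : 0 < S := by positivity
  -- The largest admissible real `n`. Taking `ε₀ = θ` makes `r ≥ 1`, so its floor is at least `r /
  -- 2`.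
  set r := √(θ * S / ε) with hr
  have hr1 : 1 ≤ r := by
    rw [hr, Real.one_le_sqrt, one_le_div hε]
    exact hεS
  set n := ⌊r⌋₊ with hn
  have hn1 : 1 ≤ n := Nat.le_floor (by exact_mod_cast hr1)
  have hn' : (0 : ℝ) < n := by exact_mod_cast hn1
  have hnr : (n : ℝ) ≤ r := Nat.floor_le (by positivity)
  have hrn : r / 2 ≤ n := by
    have h1 := Nat.lt_floor_add_one r
    have h2 : (1 : ℝ) ≤ n := by exact_mod_cast hn1
    rw [← hn] at h1
    linarith
  have hn2 : ε * n ^ 2 ≤ θ * S := by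
    have : (n : ℝ) ^ 2 ≤ θ * S / ε := by
      rw [← Real.sq_sqrt (by positivity : 0 ≤ θ * S / ε)]
      gcongr
    rw [le_div_iff₀ hε] at this
    linarith
  have hmain := le_convexEntropy_of_cells hd hqp hab hB hn1 hε (by
    rw [← hV, ← hκ]
    have e : B * V ^ (-(p⁻¹).toReal) / (d + 1) * (3 / 4 * (1 / (2 * n)) ^ 2) * V ^ (q⁻¹).toReal * κ
        = 2 * (θ * S / n ^ 2) := by
      rw [hS, hθ, Real.rpow_sub hVpos, Real.rpow_neg hVpos.le]
      field_simp
      norm_num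
    rw [e]
    have : ε ≤ θ * S / n ^ 2 := (le_div_iff₀ (by positivity)).2 hn2
    linarith)
  refine le_trans (EReal.coe_le_coe_iff.2 ?_) hmain
  have hrd : r ^ d = θ ^ ((d : ℝ) / 2) * (ε / S) ^ (-(d : ℝ) / 2) := by
    rw [hr, Real.sqrt_eq_rpow, ← Real.rpow_natCast, ← Real.rpow_mul (by positivity),
      show θ * S / ε = θ * (ε / S)⁻¹ by field_simp, Real.mul_rpow (by positivity) (by positivity),
      Real.inv_rpow (by positivity), ← Real.rpow_neg (by positivity)]
    congr 2 <;> ring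
  calc packingRate * ((1 / 2) ^ d * θ ^ ((d : ℝ) / 2)) * (ε / S) ^ (-(d : ℝ) / 2)
      = packingRate * (r / 2) ^ d := by rw [div_eq_mul_one_div r, mul_pow, hrd]; ring
    _ ≤ packingRate * n ^ d := by gcongr

end LowerBound

theorem theorem2 (d : ℕ) (hd : 1 ≤ d) (p q : ℝ≥0∞) [Fact (1 ≤ q)] (hqp : q < p) :
    ∃ c₁ c₂ ε₀ : ℝ, 0 < c₁ ∧ 0 < c₂ ∧ 0 < ε₀ ∧
      ∀ (a b : Fin d → ℝ) (B : ℝ), (∀ i, a i < b i) → 0 < B →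
        (∀ ε : ℝ, 0 < ε →
          convexEntropy p q a b B ε
            ≤ ((c₁ * (ε / entropyScale p q a b B) ^ (-(d : ℝ) / 2) : ℝ) : EReal)) ∧
        (∀ ε : ℝ, 0 < ε → ε ≤ ε₀ * entropyScale p q a b B →
          ((c₂ * (ε / entropyScale p q a b B) ^ (-(d : ℝ) / 2) : ℝ) : EReal)
            ≤ convexEntropy p q a b B ε) := by
  obtain ⟨c₁, hc₁, h₁⟩ := exists_convexEntropy_le d hd p q hqp
  obtain ⟨c₂, ε₀, hc₂, hε₀, h₂⟩ := exists_le_convexEntropy d hd p q hqp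
  exact ⟨c₁, c₂, ε₀, hc₁, hc₂, hε₀, fun a b B hab hB => ⟨h₁ a b B hab hB, h₂ a b B hab hB⟩⟩
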